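/- Let $\Delta(s)=2^s\pi^{s-1}\Gamma(1-s)\sin(\pi s/2)$ be the factor in the functional equation $\zeta(s)=\Delta(s)\zeta(1-s)$ of the Riemann zeta-function, and fix a complex number $a\neq 0$. The $a$-points of $\Delta$ are the solutions $\delta_a=\beta_a+i\gamma_a$ of $\Delta(s)=a$. (1) Let $t_0\ge 0$ and $1/2<B\le\infty$, and suppose that $t_0>0$, or $B<\infty$, or $a$ is real. Then for every $T$ the number $N_a(T)$ of $a$-points with $-1<\beta_a<B$ and $t_0<\gamma_a<T$ is finite, and, as $T\to\infty$, $$N_a(T)=\frac{T}{2\pi}\log\frac{T}{2\pi e}+O(\log T),$$ where the implicit constant depends only on $a$, $t_0$ and $B$. This holds whether or not the $a$-points are counted with multiplicity. (2) $\beta_a\to 1/2$ as $\gamma_a\to\infty$, where $\delta_a$ runs through all $a$-points. (3) The critical line is the only vertical Julia line for $\Delta$: a real number $\sigma$ has the property that for every $\varepsilon>0$ and every $T>0$ all complex numbers $b$, with at most one exception, are values $b=\Delta(z)$ at some $z$ with $|\operatorname{Re} z-\sigma|<\varepsilon$ and $\operatorname{Im} z>T$, if and only if $\sigma=1/2$.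 -/

import Mathlib

open Complex Filter Topology Asymptotics

noncomputable section

/-- The factor `Δ(s) = 2^s π^(s-1) Γ(1-s) sin(πs/2)` of the functional equation
`ζ(s) = Δ(s) ζ(1-s)`. Everything below only uses its values in the open upper half-plane, where
the formula has no singularities. -/
def feDelta (s : ℂ) : ℂ :=
  2 ^ s * (Real.pi : ℂ) ^ (s - 1) * Complex.Gamma (1 - s) * Complex.sin (Real.pi * s / 2)

/-- The `a`-points `β + iγ` of `Δ` with `-1 < β < B` and `t₀ < γ < T`
(`B = ⊤` means that there is no upper bound for `β`). -/
def aPoints (a : ℂ) (t₀ : ℝ) (B : EReal) (T : ℝ) : Set ℂ :=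
  {s : ℂ | feDelta s = a ∧ -1 < s.re ∧ (s.re : EReal) < B ∧ t₀ < s.im ∧ s.im < T}

/-- The number of `a`-points in `aPoints a t₀ B T`, counted with multiplicity. -/
def aPointCount (a : ℂ) (t₀ : ℝ) (B : EReal) (T : ℝ) : ℕ :=
  ∑ᶠ s ∈ aPoints a t₀ B T, analyticOrderNatAt (fun z : ℂ => feDelta z - a) s

/-- The vertical line `σ + iℝ` is a Julia line for `f` (at infinity, in the upward direction):
for every `ε > 0` and `T > 0`, every complex number with at most one exception is a value `f z`
with `|Re z - σ| < ε` and `Im z > T`. -/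
def IsVerticalJuliaLine (f : ℂ → ℂ) (σ : ℝ) : Prop :=
  ∀ ε : ℝ, 0 < ε → ∀ T : ℝ, 0 < T →
    {a : ℂ | ¬ ∃ z : ℂ, f z = a ∧ |z.re - σ| < ε ∧ T < z.im}.Subsingleton

end

/-- The functional equation, which identifies `feDelta`. -/
theorem riemannZeta_eq_feDelta_mul {s : ℂ} (hs : 0 < s.im) :
    riemannZeta s = feDelta s * riemannZeta (1 - s) := by
  have h1 : ∀ n : ℕ, 1 - s ≠ -n := by
    intro n h
    have := congrArg Complex.im h
    simp at this
    exact hs.ne' this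
  have h2 : 1 - s ≠ 1 := by
    intro h
    have := congrArg Complex.im h
    simp at this
    exact hs.ne' this
  have h := riemannZeta_one_sub h1 h2
  rw [sub_sub_cancel] at h
  have hpi : (Real.pi : ℂ) ≠ 0 := by exact_mod_cast Real.pi_ne_zero
  have hcos : Complex.cos (Real.pi * (1 - s) / 2) = Complex.sin (Real.pi * s / 2) := by
    rw [← Complex.cos_pi_div_two_sub]
    congr 1
    ring
  have hpow : (2 : ℂ) * (2 * Real.pi) ^ (-(1 - s)) = 2 ^ s * (Real.pi : ℂ) ^ (s - 1) := by
    have h3 := Complex.mul_cpow_ofReal_nonneg (a := 2) (b := Real.pi) (by norm_num)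
      Real.pi_pos.le (-(1 - s))
    push_cast at h3
    rw [h3, neg_sub, ← mul_assoc, Complex.cpow_sub _ _ two_ne_zero, Complex.cpow_one]
    field_simp
  rw [h, hcos, hpow, feDelta]

/-!
By the functional equation and the reflection formula, `Δ(s) = 1 / (Γ_ℂ(s) cos(πs/2))` in the upper
half-plane. Stirling's formula for the digamma function, obtained by summing its recurrence, gives
`Δ'/Δ(s) = -log(t/2π) + O((1 + σ)/t)` for `s = σ + it` with `σ > 0`, and its real part is negative
for large `t` uniformly in `σ`. Since `|Δ| = 1` on the critical line, `|Δ(s)| = |a|` forces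
`σ → 1/2`; the part `σ < 1/2` follows by the reflection `s ↦ 1 - conj s`. A branch of `log Δ` has
derivative close to `-log(t/2π)`, hence is univalent high up and maps small discs about the critical
line onto large discs. So the high `a`-points correspond to the integers `n` for which
`arg a + 2πn` lies between the values of `arg Δ(1/2 + it)` at the two ends, up to `O(log T)` of
them, and `arg Δ(1/2 + iT) = -T log(T/2πe) + O(log T)` by integration. Each of them is simple and
there are infinitely many for every `a ≠ 0`, which settles the multiplicities and the Julia lines.
Finiteness below a given height comes from the growth of `Γ_ℂ` to the right; when `a` is real and
`a`-points could approach the real axis, one compares imaginary parts in `a cos(πs/2) = 1 / Γ_ℂ(s)`.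
-/

section Digamma

/-- The error `ψ(z) - log z` in the first term of Stirling's formula for the digamma function. -/
noncomputable def digammaSubLog (z : ℂ) : ℂ := digamma z - log z

/-- The second order remainder of `log (1 + z⁻¹)`; by the functional equation of the digamma
function it is the difference of two consecutive values of `digammaSubLog`. -/
noncomputable def logRemainder (z : ℂ) : ℂ := log (1 + z⁻¹) - z⁻¹

theorem norm_logRemainder_le {z : ℂ} (hz : 2 ≤ ‖z‖) : ‖logRemainder z‖ ≤ (‖z‖ ^ 2)⁻¹ := by
  have hinv : ‖z⁻¹‖ ≤ 2⁻¹ := by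
    rw [norm_inv]
    exact inv_anti₀ (by norm_num) hz
  have hfactor : (1 - ‖z⁻¹‖)⁻¹ ≤ 2 := by
    rw [inv_le_comm₀ (by linarith) (by norm_num)]
    linarith
  calc ‖logRemainder z‖ ≤ ‖z⁻¹‖ ^ 2 * (1 - ‖z⁻¹‖)⁻¹ / 2 :=
        norm_log_one_add_sub_self_le (hinv.trans_lt (by norm_num))
    _ ≤ ‖z⁻¹‖ ^ 2 * 2 / 2 := by gcongr
    _ = (‖z‖ ^ 2)⁻¹ := by rw [norm_inv, inv_pow]; ring

theorem ne_neg_natCast_of_re_pos {z : ℂ} (hz : 0 < z.re) (m : ℕ) : z ≠ -m := by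
  rintro rfl
  simp only [neg_re, natCast_re, neg_pos] at hz
  exact hz.not_ge m.cast_nonneg

theorem re_one_add_inv_pos {z : ℂ} (hz : 0 < z.re) : 0 < (1 + z⁻¹).re := by
  have hinv : 0 ≤ z.re / normSq z := div_nonneg hz.le (normSq_nonneg z)
  simp only [add_re, one_re, inv_re]
  linarith

theorem log_add_one_of_re_pos {z : ℂ} (hz : 0 < z.re) :
    log (z + 1) = log z + log (1 + z⁻¹) := by
  have hz0 : z ≠ 0 := ne_zero_of_re_pos hz
  have hpos := re_one_add_inv_pos hz
  have hfactor : z + 1 = z * (1 + z⁻¹) := by field_simp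
  have harg₁ := abs_lt.1 (abs_arg_lt_pi_div_two_iff.2 (Or.inl hz))
  have harg₂ := abs_lt.1 (abs_arg_lt_pi_div_two_iff.2 (Or.inl hpos))
  rw [hfactor, log_mul hz0 (ne_zero_of_re_pos hpos)]
  constructor <;> linarith [harg₁.1, harg₁.2, harg₂.1, harg₂.2]

theorem digammaSubLog_eq_add {z : ℂ} (hz : 0 < z.re) :
    digammaSubLog z = logRemainder z + digammaSubLog (z + 1) := by
  rw [digammaSubLog, digammaSubLog, logRemainder,
    digamma_apply_add_one z (ne_neg_natCast_of_re_pos hz), log_add_one_of_re_pos hz]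
  ring

theorem digammaSubLog_eq_sum_add {z : ℂ} (hz : 0 < z.re) (N : ℕ) :
    digammaSubLog z = ∑ j ∈ Finset.range N, logRemainder (z + j) + digammaSubLog (z + N) := by
  induction N with
  | zero => simp
  | succ n ih =>
    have hzn : 0 < (z + n).re := by
      simp only [add_re, natCast_re]
      positivity
    rw [ih, digammaSubLog_eq_add hzn, Finset.sum_range_succ]
    push_cast
    ring_nf

theorem digamma_ofReal {x : ℝ} (hx : 0 < x) : digamma x = (logDeriv Real.Gamma x : ℝ) := by
  have hreal := (Real.differentiableAt_Gamma fun m => by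
    have : (0 : ℝ) ≤ m := m.cast_nonneg
    linarith).hasDerivAt.ofReal_comp (z := x)
  have hcomplex := (differentiableAt_Gamma (x : ℂ)
    (ne_neg_natCast_of_re_pos (by simpa using hx))).hasDerivAt.comp_ofReal
  simp only [Gamma_ofReal] at hcomplex
  rw [digamma_def, logDeriv_apply, logDeriv_apply, hcomplex.unique hreal, Gamma_ofReal, ofReal_div]

theorem hasDerivAt_log_comp_Gamma {x : ℝ} (hx : 0 < x) :
    HasDerivAt (Real.log ∘ Real.Gamma) (logDeriv Real.Gamma x) x :=
  (Real.differentiableAt_Gamma fun m => by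
    have : (0 : ℝ) ≤ m := m.cast_nonneg
    linarith).hasDerivAt.log (Real.Gamma_pos_of_pos hx).ne'

theorem slope_log_comp_Gamma_add_one {x : ℝ} (hx : 0 < x) :
    slope (Real.log ∘ Real.Gamma) x (x + 1) = Real.log x := by
  rw [slope_def_field, Function.comp_apply, Function.comp_apply, Real.Gamma_add_one hx.ne',
    Real.log_mul hx.ne' (Real.Gamma_pos_of_pos hx).ne']
  ring

theorem logDeriv_Gamma_le_log {x : ℝ} (hx : 0 < x) : logDeriv Real.Gamma x ≤ Real.log x := by
  have hderiv := hasDerivAt_log_comp_Gamma hx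
  rw [← hderiv.deriv, ← slope_log_comp_Gamma_add_one hx]
  exact Real.convexOn_log_Gamma.deriv_le_slope hx (Set.mem_Ioi.2 (by linarith)) (by linarith)
    hderiv.differentiableAt

theorem log_le_logDeriv_Gamma_add_one {x : ℝ} (hx : 0 < x) :
    Real.log x ≤ logDeriv Real.Gamma (x + 1) := by
  have hderiv := hasDerivAt_log_comp_Gamma (x := x + 1) (by linarith)
  rw [← hderiv.deriv, ← slope_log_comp_Gamma_add_one hx]
  exact Real.convexOn_log_Gamma.slope_le_deriv hx (Set.mem_Ioi.2 (by linarith)) (by linarith)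
    hderiv.differentiableAt

theorem norm_digammaSubLog_ofReal_add_one_le {x : ℝ} (hx : 0 < x) :
    ‖digammaSubLog (x + 1)‖ ≤ x⁻¹ := by
  have hx1 : 0 < x + 1 := by linarith
  have hlog : Real.log (x + 1) - Real.log x ≤ x⁻¹ := by
    rw [← Real.log_div hx1.ne' hx.ne']
    refine (Real.log_le_sub_one_of_pos (by positivity)).trans_eq ?_
    field_simp
    ring
  have hle := logDeriv_Gamma_le_log hx1
  have hge := log_le_logDeriv_Gamma_add_one hx
  rw [digammaSubLog, ← ofReal_one, ← ofReal_add, digamma_ofReal hx1, ← ofReal_log hx1.le,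
    ← ofReal_sub, norm_real, Real.norm_eq_abs, abs_le]
  constructor <;> linarith

theorem tendsto_digammaSubLog_ofReal_add_natCast (x : ℝ) :
    Tendsto (fun N : ℕ => digammaSubLog ((x : ℂ) + N)) atTop (𝓝 0) := by
  have hatTop : Tendsto (fun N : ℕ => x - 1 + N) atTop atTop :=
    tendsto_atTop_add_const_left _ _ tendsto_natCast_atTop_atTop
  refine squeeze_zero_norm' ?_ (tendsto_inv_atTop_zero.comp hatTop)
  filter_upwards [hatTop.eventually_gt_atTop 0] with N hN
  have hbound := norm_digammaSubLog_ofReal_add_one_le hN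
  push_cast at hbound
  rwa [show (x : ℂ) - 1 + N + 1 = x + N by ring] at hbound

theorem summable_inv_add_one_sq : Summable fun j : ℕ => (((j : ℝ) + 1) ^ 2)⁻¹ := by
  simpa using (summable_nat_add_iff 1).2 (Real.summable_nat_pow_inv.2 one_lt_two)

theorem norm_logRemainder_add_natCast_le {z : ℂ} (hz : 2 < z.re) (j : ℕ) :
    ‖logRemainder (z + j)‖ ≤ (((j : ℝ) + 1) ^ 2)⁻¹ := by
  have hnorm : 2 + (j : ℝ) ≤ ‖z + j‖ := by
    refine le_trans ?_ (re_le_norm _)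
    simp only [add_re, natCast_re]
    linarith
  have : (0 : ℝ) ≤ j := j.cast_nonneg
  refine (norm_logRemainder_le (by linarith)).trans ?_
  gcongr
  linarith

theorem differentiableAt_logRemainder {z : ℂ} (hz : 0 < z.re) :
    DifferentiableAt ℂ logRemainder z := by
  have hinv := differentiableAt_inv (𝕜 := ℂ) (ne_zero_of_re_pos hz)
  exact ((hinv.const_add 1).clog (Or.inl (re_one_add_inv_pos hz))).sub hinv

theorem differentiableAt_digamma {z : ℂ} (hz : 0 < z.re) : DifferentiableAt ℂ digamma z := by
  have hopen : IsOpen {w : ℂ | 0 < w.re} := isOpen_lt continuous_const continuous_re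
  have hGamma : DifferentiableOn ℂ Gamma {w : ℂ | 0 < w.re} := fun w hw =>
    (differentiableAt_Gamma w (ne_neg_natCast_of_re_pos hw)).differentiableWithinAt
  exact ((hGamma.deriv hopen).div hGamma fun w hw => Gamma_ne_zero_of_re_pos hw).differentiableAt
    (hopen.mem_nhds hz)

theorem differentiableAt_digammaSubLog {z : ℂ} (hz : 0 < z.re) :
    DifferentiableAt ℂ digammaSubLog z :=
  (differentiableAt_digamma hz).sub (differentiableAt_log (Or.inl hz))

theorem differentiableOn_tsum_logRemainder :
    DifferentiableOn ℂ (fun z => ∑' j : ℕ, logRemainder (z + j)) {z : ℂ | 2 < z.re} := by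
  refine differentiableOn_tsum_of_summable_norm summable_inv_add_one_sq (fun j z hz => ?_)
    (isOpen_lt continuous_const continuous_re)
    (fun j z hz => norm_logRemainder_add_natCast_le hz j)
  have hzj : 0 < (z + j).re := by
    have : 0 < z.re := zero_lt_two.trans hz
    simp only [add_re, natCast_re]
    positivity
  exact ((differentiableAt_logRemainder hzj).comp z
    (differentiableAt_id.add_const _)).differentiableWithinAt

theorem digammaSubLog_ofReal_eq_tsum {x : ℝ} (hx : 2 < x) :
    digammaSubLog x = ∑' j : ℕ, logRemainder (x + j) := by
  have hsummable : Summable fun j : ℕ => logRemainder (x + j) :=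
    Summable.of_norm_bounded summable_inv_add_one_sq
      (norm_logRemainder_add_natCast_le (by simpa using hx))
  have hpartial (N : ℕ) : ∑ j ∈ Finset.range N, logRemainder ((x : ℂ) + j) =
      digammaSubLog x - digammaSubLog ((x : ℂ) + N) :=
    eq_sub_of_add_eq (digammaSubLog_eq_sum_add (by simp; linarith) N).symm
  refine tendsto_nhds_unique ?_ hsummable.hasSum.tendsto_sum_nat
  simpa only [hpartial, sub_zero] using
    tendsto_const_nhds.sub (tendsto_digammaSubLog_ofReal_add_natCast x)

theorem frequently_nhdsNE_of_forall_ofReal {p : ℂ → Prop} {x₀ : ℝ} (hp : ∀ x > x₀, p (x : ℝ)) :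
    ∃ᶠ z in 𝓝[≠] (x₀ : ℂ), p z := by
  have hright : ∀ᶠ x : ℝ in 𝓝[>] x₀, x₀ < x := eventually_mem_nhdsWithin
  have htendsto : Tendsto ((↑) : ℝ → ℂ) (𝓝[>] x₀) (𝓝[≠] (x₀ : ℂ)) :=
    tendsto_nhdsWithin_iff.2 ⟨continuous_ofReal.continuousAt.mono_left nhdsWithin_le_nhds,
      hright.mono fun x hx => by simpa using hx.ne'⟩
  exact htendsto.frequently (hright.mono hp).frequently

theorem digammaSubLog_eq_tsum {z : ℂ} (hz : 2 < z.re) :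
    digammaSubLog z = ∑' j : ℕ, logRemainder (z + j) := by
  have hopen : IsOpen {w : ℂ | 2 < w.re} := isOpen_lt continuous_const continuous_re
  have hdiff : DifferentiableOn ℂ digammaSubLog {w : ℂ | 2 < w.re} := fun w hw =>
    (differentiableAt_digammaSubLog (zero_lt_two.trans hw)).differentiableWithinAt
  have hreal : ∃ᶠ w in 𝓝[≠] ((3 : ℝ) : ℂ), digammaSubLog w = ∑' j : ℕ, logRemainder (w + j) :=
    frequently_nhdsNE_of_forall_ofReal fun x hx => digammaSubLog_ofReal_eq_tsum (by linarith)
  exact (hdiff.analyticOnNhd hopen).eqOn_of_preconnected_of_frequently_eq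
    (differentiableOn_tsum_logRemainder.analyticOnNhd hopen)
    (convex_halfSpace_re_gt 2).isPreconnected (by simp; norm_num) hreal hz

theorem tendsto_digammaSubLog_add_natCast {z : ℂ} (hz : 0 < z.re) :
    Tendsto (fun N : ℕ => digammaSubLog (z + N)) atTop (𝓝 0) := by
  rw [← tendsto_add_atTop_iff_nat 3]
  refine (tendsto_sum_nat_add fun j : ℕ => logRemainder (z + 3 + j)).congr fun N => ?_
  have hre : 2 < (z + (N + 3 : ℕ)).re := by
    simp only [add_re, natCast_re]
    push_cast
    linarith [(N.cast_nonneg : (0 : ℝ) ≤ N)]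
  rw [digammaSubLog_eq_tsum hre]
  congr 1 with j
  push_cast
  ring_nf

-- In the right half-plane `‖z + n‖² ≥ ‖z‖² + n² ≥ (‖z‖ + n)² / 2`.
theorem norm_logRemainder_add_natCast_le_sub {z : ℂ} (hz : 0 < z.re) (hnorm : 2 ≤ ‖z‖) (n : ℕ) :
    ‖logRemainder (z + n)‖ ≤ 2 / (‖z‖ - 1 + n) - 2 / (‖z‖ - 1 + (n + 1)) := by
  have hn : (0 : ℝ) ≤ n := n.cast_nonneg
  have hsq : ‖z‖ ^ 2 + (n : ℝ) ^ 2 ≤ ‖z + n‖ ^ 2 := by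
    rw [← normSq_eq_norm_sq, ← normSq_eq_norm_sq, normSq_apply, normSq_apply]
    simp only [add_re, natCast_re, add_im, natCast_im, add_zero]
    nlinarith [mul_nonneg hz.le hn]
  have hge : 2 ≤ ‖z + n‖ := hnorm.trans (abs_le_of_sq_le_sq' (by nlinarith) (norm_nonneg _)).2
  have hlow : (‖z‖ - 1 + n) * (‖z‖ + n) / 2 ≤ ‖z + n‖ ^ 2 := by
    nlinarith [sq_nonneg (‖z‖ - n)]
  have hpos₁ : 0 < ‖z‖ - 1 + n := by linarith
  have : 0 < ‖z‖ + n := by linarith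
  calc ‖logRemainder (z + n)‖ ≤ (‖z + n‖ ^ 2)⁻¹ := norm_logRemainder_le hge
    _ ≤ ((‖z‖ - 1 + n) * (‖z‖ + n) / 2)⁻¹ := by gcongr
    _ = 2 / (‖z‖ - 1 + n) - 2 / (‖z‖ - 1 + (n + 1)) := by
      rw [show ‖z‖ - 1 + (n + 1) = ‖z‖ + n by ring]
      field_simp
      ring

theorem norm_digammaSubLog_le {z : ℂ} (hz : 0 < z.re) (hnorm : 2 ≤ ‖z‖) :
    ‖digammaSubLog z‖ ≤ 4 / ‖z‖ := by
  have hsum (N : ℕ) : ‖∑ j ∈ Finset.range N, logRemainder (z + j)‖ ≤ 2 / (‖z‖ - 1) := by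
    have hlast : 0 ≤ 2 / (‖z‖ - 1 + N) := by
      have : (0 : ℝ) ≤ N := N.cast_nonneg
      exact div_nonneg zero_le_two (by linarith)
    have htele := Finset.sum_range_sub' (fun n : ℕ => 2 / (‖z‖ - 1 + n)) N
    push_cast at htele
    have := norm_sum_le_of_le (Finset.range N) fun n _ =>
      norm_logRemainder_add_natCast_le_sub hz hnorm n
    rw [htele, add_zero] at this
    linarith
  have hbound (N : ℕ) : ‖digammaSubLog z‖ ≤ 2 / (‖z‖ - 1) + ‖digammaSubLog (z + N)‖ := by
    rw [digammaSubLog_eq_sum_add hz N]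
    exact (norm_add_le _ _).trans (by gcongr; exact hsum N)
  have hlim : Tendsto (fun N : ℕ => 2 / (‖z‖ - 1) + ‖digammaSubLog (z + N)‖) atTop
      (𝓝 (2 / (‖z‖ - 1) + 0)) := by
    simpa only [norm_zero] using
      tendsto_const_nhds.add (tendsto_digammaSubLog_add_natCast hz).norm
  have hle : 2 / (‖z‖ - 1) ≤ 4 / ‖z‖ := by
    rw [div_le_div_iff₀ (by linarith) (by linarith)]
    linarith
  simpa using (ge_of_tendsto' hlim hbound).trans (by simpa using hle)

end Digamma

section Trigonometric

theorem norm_cos_sq (w : ℂ) : ‖cos w‖ ^ 2 = Real.cos w.re ^ 2 + Real.sinh w.im ^ 2 := by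
  rw [← normSq_eq_norm_sq, Complex.cos_eq, ← ofReal_cos, ← ofReal_cosh, ← ofReal_sin, ← ofReal_sinh,
    ← ofReal_mul, ← ofReal_mul, sub_eq_add_neg, ← neg_mul, ← ofReal_neg, normSq_add_mul_I]
  linear_combination Real.cos w.re ^ 2 * Real.cosh_sq w.im +
    Real.sinh w.im ^ 2 * Real.sin_sq_add_cos_sq w.re

theorem im_le_norm_cos {w : ℂ} (hw : 0 ≤ w.im) : w.im ≤ ‖cos w‖ := by
  refine (Real.self_le_sinh_iff.2 hw).trans (abs_le_of_sq_le_sq' ?_ (norm_nonneg _)).2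
  rw [norm_cos_sq]
  exact le_add_of_nonneg_left (sq_nonneg _)

theorem cos_ne_zero_of_im_pos {w : ℂ} (hw : 0 < w.im) : cos w ≠ 0 :=
  norm_pos_iff.1 (hw.trans_le (im_le_norm_cos hw.le))

theorem cos_pi_mul_div_two_ne_zero {s : ℂ} (hs : 0 < s.im) : cos (Real.pi * s / 2) ≠ 0 :=
  cos_ne_zero_of_im_pos (by simpa using mul_pos Real.pi_pos hs)

theorem norm_tan_sub_I_le {w : ℂ} (hw : 0 < w.im) : ‖tan w - I‖ ≤ 1 / w.im := by
  have hcos : cos w ≠ 0 := cos_ne_zero_of_im_pos hw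
  have hquot : tan w - I = -I * exp (w * I) / cos w := by
    rw [Complex.tan, exp_mul_I]
    field_simp
    linear_combination sin w * I_sq
  have hexp : ‖exp (w * I)‖ ≤ 1 := by
    rw [norm_exp]
    simpa using hw.le
  rw [hquot, norm_div, norm_mul, norm_neg, norm_I, one_mul]
  exact div_le_div₀ zero_le_one hexp hw (im_le_norm_cos hw.le)

theorem norm_log_sub_le {s : ℂ} (hs : 0 < s.im) :
    ‖log s - (Real.log s.im + Real.pi / 2 * I)‖ ≤ |s.re| / s.im := by
  have hlog : log (s.im * I) = Real.log s.im + Real.pi / 2 * I := by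
    rw [log_ofReal_mul hs I_ne_zero, log_I]
  have hmvt := Convex.norm_image_sub_le_of_norm_hasDerivWithin_le (f := log) (f' := (·⁻¹))
    (s := {z : ℂ | s.im ≤ z.im}) (C := s.im⁻¹) (x := s.im * I) (y := s)
    (fun z hz => (hasDerivAt_log (Or.inr (hs.trans_le hz).ne')).hasDerivWithinAt)
    (fun z hz => by
      rw [norm_inv]
      exact inv_anti₀ hs ((show s.im ≤ z.im from hz).trans ((le_abs_self _).trans
        (abs_im_le_norm z))))
    (convex_halfSpace_im_ge s.im) (by simp) (le_refl s.im)
  have hsub : s - s.im * I = s.re := by linear_combination -re_add_im s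
  rwa [hlog, hsub, norm_real, Real.norm_eq_abs, ← div_eq_inv_mul] at hmvt

end Trigonometric

section FunctionalEquationFactor

theorem feDelta_one_sub (s : ℂ) : feDelta (1 - s) = Gammaℂ s * cos (Real.pi * s / 2) := by
  have hpow : (2 * Real.pi : ℂ) ^ (-s) = 2 ^ (-s) * (Real.pi : ℂ) ^ (-s) := by
    exact_mod_cast mul_cpow_ofReal_nonneg zero_le_two Real.pi_pos.le (-s)
  have hsin : sin (Real.pi * (1 - s) / 2) = cos (Real.pi * s / 2) := by
    rw [← sin_pi_div_two_sub]
    congr 1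
    ring
  rw [feDelta, Gammaℂ_def, hpow, hsin, sub_sub_cancel, sub_eq_add_neg 1 s,
    cpow_add _ _ two_ne_zero, cpow_one, show 1 + -s - 1 = -s by ring]
  ring

theorem feDelta_mul_feDelta_one_sub {s : ℂ} (hs : s.im ≠ 0) :
    feDelta s * feDelta (1 - s) = 1 := by
  have hpi : (Real.pi : ℂ) ≠ 0 := ofReal_ne_zero.2 Real.pi_ne_zero
  have hsin : sin (Real.pi * s) ≠ 0 := by
    rw [Ne, Complex.sin_eq_zero_iff]
    rintro ⟨k, hk⟩
    rw [mul_comm] at hk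
    exact hs (by rw [mul_right_cancel₀ hpi hk, intCast_im])
  have hGamma := Gamma_mul_Gamma_one_sub s
  rw [eq_div_iff hsin, show (Real.pi : ℂ) * s = 2 * (Real.pi * s / 2) by ring, sin_two_mul]
    at hGamma
  have hpow : (2 : ℂ) ^ s * (Real.pi : ℂ) ^ (s - 1) * (2 * (2 * Real.pi) ^ (-s)) *
      Real.pi = 2 := by
    have h2pi : (2 * Real.pi : ℂ) ^ (-s) = 2 ^ (-s) * (Real.pi : ℂ) ^ (-s) := by
      exact_mod_cast mul_cpow_ofReal_nonneg zero_le_two Real.pi_pos.le (-s)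
    have h2 : (2 : ℂ) ^ s ≠ 0 := by simp [cpow_eq_zero_iff]
    have hpis : (Real.pi : ℂ) ^ s ≠ 0 := by simp [cpow_eq_zero_iff, hpi]
    rw [h2pi, cpow_sub _ _ hpi, cpow_one, cpow_neg, cpow_neg]
    field_simp
  rw [feDelta_one_sub, feDelta, Gammaℂ_def]
  apply mul_right_cancel₀ hpi
  linear_combination (2 : ℂ) ^ s * (Real.pi : ℂ) ^ (s - 1) * (2 * Real.pi) ^ (-s) * Real.pi * hGamma
    + Real.pi / 2 * hpow

theorem feDelta_ne_zero {s : ℂ} (hs : s.im ≠ 0) : feDelta s ≠ 0 :=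
  left_ne_zero_of_mul_eq_one (feDelta_mul_feDelta_one_sub hs)

theorem feDelta_eq_inv {s : ℂ} (hs : s.im ≠ 0) :
    feDelta s = (Gammaℂ s * cos (Real.pi * s / 2))⁻¹ := by
  rw [← feDelta_one_sub]
  exact eq_inv_of_mul_eq_one_left (feDelta_mul_feDelta_one_sub hs)

theorem Gammaℂ_conj (s : ℂ) : Gammaℂ (starRingEnd ℂ s) = starRingEnd ℂ (Gammaℂ s) := by
  have harg : arg (2 * Real.pi : ℂ) ≠ Real.pi := by
    rw [show (2 * Real.pi : ℂ) = ((2 * Real.pi : ℝ) : ℂ) by push_cast; rfl,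
      arg_ofReal_of_nonneg Real.two_pi_pos.le]
    exact Real.pi_ne_zero.symm
  have hpow := cpow_conj (2 * Real.pi : ℂ) (-s) harg
  simp only [map_neg, map_mul, conj_ofNat, conj_ofReal] at hpow
  simp only [Gammaℂ_def, map_mul, conj_ofNat, hpow, Gamma_conj]

theorem cos_pi_mul_conj_div_two (s : ℂ) :
    cos (Real.pi * starRingEnd ℂ s / 2) = starRingEnd ℂ (cos (Real.pi * s / 2)) := by
  rw [← cos_conj, map_div₀, map_mul, conj_ofReal, conj_ofNat]

theorem norm_feDelta_mul_norm {s : ℂ} (hs : s.im ≠ 0) :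
    ‖feDelta s‖ * ‖feDelta (1 - starRingEnd ℂ s)‖ = 1 := by
  rw [feDelta_one_sub, Gammaℂ_conj, cos_pi_mul_conj_div_two, ← map_mul, norm_conj,
    ← feDelta_one_sub, ← norm_mul, feDelta_mul_feDelta_one_sub hs, norm_one]

theorem norm_feDelta_eq_one {s : ℂ} (hre : s.re = 1 / 2) (him : s.im ≠ 0) : ‖feDelta s‖ = 1 := by
  have hsymm : 1 - starRingEnd ℂ s = s := Complex.ext (by simp [hre]; norm_num) (by simp)
  have hmul := norm_feDelta_mul_norm him
  rw [hsymm, ← sq] at hmul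
  exact (pow_eq_one_iff_of_nonneg (norm_nonneg _) two_ne_zero).1 hmul

theorem differentiableAt_Gammaℂ {s : ℂ} (hs : 0 < s.re) : DifferentiableAt ℂ Gammaℂ s := by
  have hpow : DifferentiableAt ℂ (fun z : ℂ => (2 * Real.pi : ℂ) ^ (-z)) s :=
    differentiableAt_id.fun_neg.const_cpow (Or.inl (by simp))
  exact (hpow.const_mul 2).mul (differentiableAt_Gamma s (ne_neg_natCast_of_re_pos hs))

theorem Gammaℂ_ne_zero {s : ℂ} (hs : 0 < s.re) : Gammaℂ s ≠ 0 := by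
  rw [Gammaℂ_def]
  exact mul_ne_zero (mul_ne_zero two_ne_zero (by simp [cpow_eq_zero_iff]))
    (Gamma_ne_zero_of_re_pos hs)

theorem logDeriv_Gammaℂ {s : ℂ} (hs : 0 < s.re) :
    logDeriv Gammaℂ s = digamma s - Real.log (2 * Real.pi) := by
  have hbase : (2 * Real.pi : ℂ) ≠ 0 := by simp
  have hlog : log (2 * Real.pi : ℂ) = Real.log (2 * Real.pi) := by
    rw [ofReal_log Real.two_pi_pos.le, ofReal_mul, ofReal_ofNat]
  have hpow : HasDerivAt (fun z : ℂ => (2 * Real.pi : ℂ) ^ (-z)) _ s :=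
    (hasDerivAt_id s).fun_neg.const_cpow (Or.inl hbase)
  have hpow0 : (2 * Real.pi : ℂ) ^ (-s) ≠ 0 := by simp [cpow_eq_zero_iff]
  have hpowDeriv : logDeriv (fun z : ℂ => (2 * Real.pi : ℂ) ^ (-z)) s =
      -Real.log (2 * Real.pi) := by
    rw [logDeriv_apply, hpow.deriv, hlog, id, mul_assoc, mul_div_cancel_left₀ _ hpow0, mul_neg_one]
  rw [show Gammaℂ = fun z => 2 * (2 * Real.pi : ℂ) ^ (-z) * Gamma z from funext Gammaℂ_def,
    logDeriv_mul (f := fun z => 2 * (2 * Real.pi : ℂ) ^ (-z)) s (mul_ne_zero two_ne_zero hpow0)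
      (Gamma_ne_zero_of_re_pos hs) (hpow.differentiableAt.const_mul 2)
      (differentiableAt_Gamma s (ne_neg_natCast_of_re_pos hs)),
    logDeriv_const_mul _ _ two_ne_zero, hpowDeriv, digamma_def]
  ring

theorem logDeriv_cos_pi_mul_div_two (s : ℂ) :
    logDeriv (fun z : ℂ => cos (Real.pi * z / 2)) s = -(Real.pi / 2 * tan (Real.pi * s / 2)) := by
  have hlin : HasDerivAt (fun z : ℂ => Real.pi * z / 2) ((Real.pi : ℂ) * 1 / 2) s :=
    ((hasDerivAt_id s).const_mul _).div_const _
  rw [logDeriv_apply, hlin.ccos.deriv, Complex.tan]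
  ring

theorem feDelta_eventuallyEq_inv {s : ℂ} (hs : s.im ≠ 0) :
    feDelta =ᶠ[𝓝 s] fun z => (Gammaℂ z * cos (Real.pi * z / 2))⁻¹ :=
  (continuous_im.continuousAt.eventually_ne hs).mono fun _ hz => feDelta_eq_inv hz

theorem differentiableAt_cos_pi_mul_div_two (s : ℂ) :
    DifferentiableAt ℂ (fun z : ℂ => cos (Real.pi * z / 2)) s := by
  fun_prop

theorem differentiableAt_feDelta {s : ℂ} (hre : 0 < s.re) (him : 0 < s.im) :
    DifferentiableAt ℂ feDelta s := by
  have hne := mul_ne_zero (Gammaℂ_ne_zero hre) (cos_pi_mul_div_two_ne_zero him)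
  exact (((differentiableAt_Gammaℂ hre).mul (differentiableAt_cos_pi_mul_div_two s)).inv
    hne).congr_of_eventuallyEq (feDelta_eventuallyEq_inv him.ne')

theorem logDeriv_feDelta {s : ℂ} (hre : 0 < s.re) (him : 0 < s.im) :
    logDeriv feDelta s =
      Real.log (2 * Real.pi) - digamma s + Real.pi / 2 * tan (Real.pi * s / 2) := by
  have hcos := cos_pi_mul_div_two_ne_zero him
  have hdiff := (differentiableAt_Gammaℂ hre).mul (differentiableAt_cos_pi_mul_div_two s)
  rw [(logDeriv_congr_nhds (feDelta_eventuallyEq_inv him.ne')).eq_of_nhds]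
  simp only [← one_div]
  rw [logDeriv_div (g := fun z => Gammaℂ z * cos (Real.pi * z / 2)) s one_ne_zero
      (mul_ne_zero (Gammaℂ_ne_zero hre) hcos) (differentiableAt_const 1) hdiff,
    logDeriv_mul s (Gammaℂ_ne_zero hre) hcos (differentiableAt_Gammaℂ hre)
      (differentiableAt_cos_pi_mul_div_two s),
    logDeriv_const, logDeriv_Gammaℂ hre, logDeriv_cos_pi_mul_div_two, Pi.zero_apply]
  ring

theorem norm_digammaSubLog_sub_tan_le {s : ℂ} (hre : 0 < s.re) (him : 2 ≤ s.im) :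
    ‖Real.pi / 2 * (tan (Real.pi * s / 2) - I) - digammaSubLog s‖ ≤ 5 / s.im := by
  have : 0 < s.im := by linarith
  have hnorm : s.im ≤ ‖s‖ := (le_abs_self _).trans (abs_im_le_norm s)
  have htan : ‖tan (Real.pi * s / 2) - I‖ ≤ 1 / (Real.pi * s.im / 2) := by
    have him_half : (Real.pi * s / 2).im = Real.pi * s.im / 2 := by simp
    rw [← him_half]
    exact norm_tan_sub_I_le (by rw [him_half]; positivity)
  calc ‖Real.pi / 2 * (tan (Real.pi * s / 2) - I) - digammaSubLog s‖
      ≤ Real.pi / 2 * ‖tan (Real.pi * s / 2) - I‖ + ‖digammaSubLog s‖ := by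
        refine (norm_sub_le _ _).trans_eq ?_
        rw [norm_mul, norm_div, norm_real, Real.norm_of_nonneg Real.pi_pos.le, norm_ofNat]
    _ ≤ Real.pi / 2 * (1 / (Real.pi * s.im / 2)) + 4 / ‖s‖ := by
        gcongr
        exact norm_digammaSubLog_le hre (him.trans hnorm)
    _ ≤ 1 / s.im + 4 / s.im := by
        gcongr
        · exact le_of_eq (by field_simp)
    _ = 5 / s.im := by ring

theorem norm_logDeriv_feDelta_add_log_le {s : ℂ} (hre : 0 < s.re) (him : 2 ≤ s.im) :
    ‖logDeriv feDelta s + Real.log (s.im / (2 * Real.pi))‖ ≤ (5 + s.re) / s.im := by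
  have him0 : 0 < s.im := by linarith
  have hsplit : logDeriv feDelta s + Real.log (s.im / (2 * Real.pi)) =
      Real.pi / 2 * (tan (Real.pi * s / 2) - I) - digammaSubLog s -
        (log s - (Real.log s.im + Real.pi / 2 * I)) := by
    rw [logDeriv_feDelta hre him0, digammaSubLog, Real.log_div him0.ne' Real.two_pi_pos.ne']
    push_cast
    ring
  have hlog := norm_log_sub_le him0
  rw [abs_of_pos hre] at hlog
  rw [hsplit, add_div]
  exact norm_sub_le_of_le (norm_digammaSubLog_sub_tan_le hre him) hlog

theorem re_logDeriv_feDelta_le {s : ℂ} (hre : 0 < s.re) (him : 2 ≤ s.im) :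
    (logDeriv feDelta s).re ≤ 5 / s.im - Real.log (s.im / (2 * Real.pi)) := by
  have him0 : 0 < s.im := by linarith
  have hsplit : logDeriv feDelta s = Real.pi / 2 * (tan (Real.pi * s / 2) - I) - digammaSubLog s +
      (Real.log (2 * Real.pi) - log s + (Real.pi / 2 : ℝ) * I) := by
    rw [logDeriv_feDelta hre him0, digammaSubLog]
    push_cast
    ring
  have hlog : Real.log s.im ≤ Real.log ‖s‖ :=
    Real.log_le_log him0 ((le_abs_self _).trans (abs_im_le_norm s))
  have hbound := (re_le_norm _).trans (norm_digammaSubLog_sub_tan_le hre him)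
  rw [hsplit, add_re, Real.log_div him0.ne' Real.two_pi_pos.ne']
  simp only [add_re (_ - log s), sub_re (ofReal _), ofReal_re, log_re, re_ofReal_mul, I_re,
    mul_zero]
  linarith

end FunctionalEquationFactor

section HolomorphicLogarithm

theorem isSimplyConnected_of_convex {U : Set ℂ} (hU : Convex ℝ U) (hne : U.Nonempty) :
    IsSimplyConnected U := by
  have := hU.contractibleSpace hne
  unfold IsSimplyConnected
  infer_instance

theorem hasDerivAt_of_exp_eventuallyEq {φ f : ℂ → ℂ} {z : ℂ} (hφ : ContinuousAt φ z)
    (hf : DifferentiableAt ℂ f z) (hexp : ∀ᶠ w in 𝓝 z, exp (φ w) = f w) :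
    HasDerivAt φ (logDeriv f z) z := by
  have hstrict := hasStrictDerivAt_exp (φ z)
  have hinv := (hstrict.to_localInverse (exp_ne_zero _)).hasDerivAt
  have hcomp := hinv.comp_of_eq z hf.hasDerivAt hexp.self_of_nhds
  have hderiv : (exp (φ z))⁻¹ * deriv f z = logDeriv f z := by
    rw [hexp.self_of_nhds, inv_mul_eq_div, logDeriv_apply]
  refine (hcomp.congr_deriv hderiv).congr_of_eventuallyEq ?_
  filter_upwards [hφ.eventually (hstrict.eventually_left_inverse (exp_ne_zero _)), hexp]
    with w hleft hw
  rw [Function.comp_apply, ← hw, hleft]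

theorem exists_hasDerivAt_log {U : Set ℂ} (hU : IsSimplyConnected U) (hUo : IsOpen U) {f : ℂ → ℂ}
    (hf : ∀ z ∈ U, DifferentiableAt ℂ f z) (hf0 : ∀ z ∈ U, f z ≠ 0) :
    ∃ φ : ℂ → ℂ, ∀ z ∈ U, exp (φ z) = f z ∧ HasDerivAt φ (logDeriv f z) z := by
  obtain ⟨φ, hφ, hexp⟩ := exists_continuousOn_eqOn_exp_comp hU hUo
    (fun z hz => (hf z hz).continuousAt.continuousWithinAt) (fun ⟨z, hz, h0⟩ => hf0 z hz h0)
  exact ⟨φ, fun z hz => ⟨hexp hz, hasDerivAt_of_exp_eventuallyEq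
    (hφ.continuousAt (hUo.mem_nhds hz)) (hf z hz)
    ((hUo.eventually_mem hz).mono fun w hw => hexp hw)⟩⟩

end HolomorphicLogarithm

section MeanValue

theorem exists_re_slope_eq_re_deriv {f f' : ℂ → ℂ} {z w : ℂ} (hne : z ≠ w)
    (hf : ∀ c ∈ segment ℝ z w, HasDerivAt f (f' c) c) :
    ∃ c ∈ segment ℝ z w, ((f w - f z) / (w - z)).re = (f' c).re := by
  have hderiv (r : ℝ) (hr : r ∈ Set.Icc (0 : ℝ) 1) :
      HasDerivAt (fun r => (f (AffineMap.lineMap z w r) / (w - z)).re)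
        (f' (AffineMap.lineMap z w r)).re r := by
    have hmem : AffineMap.lineMap z w r ∈ segment ℝ z w := by
      rw [segment_eq_image_lineMap]
      exact Set.mem_image_of_mem _ hr
    have hcomp := ((hf _ hmem).scomp r AffineMap.hasDerivAt_lineMap).div_const (w - z)
    rw [smul_eq_mul, mul_div_cancel_left₀ _ (sub_ne_zero.2 hne.symm)] at hcomp
    exact reCLM.hasFDerivAt.comp_hasDerivAt r hcomp
  obtain ⟨r, hr, hslope⟩ := exists_hasDerivAt_eq_slope _ _ zero_lt_one
    (fun r hr => (hderiv r hr).continuousAt.continuousWithinAt)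
    (fun r hr => hderiv r (Set.Ioo_subset_Icc_self hr))
  refine ⟨AffineMap.lineMap z w r, ?_, ?_⟩
  · rw [segment_eq_image_lineMap]
    exact Set.mem_image_of_mem _ (Set.Ioo_subset_Icc_self hr)
  · rw [hslope]
    simp [sub_div]

-- The Noshiro–Warschawski criterion for univalence.
theorem injOn_of_re_deriv_neg {S : Set ℂ} (hS : Convex ℝ S) {f f' : ℂ → ℂ}
    (hf : ∀ z ∈ S, HasDerivAt f (f' z) z) (hneg : ∀ z ∈ S, (f' z).re < 0) : Set.InjOn f S := by
  intro z hz w hw hzw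
  by_contra hne
  have hseg := hS.segment_subset hz hw
  obtain ⟨c, hc, hslope⟩ := exists_re_slope_eq_re_deriv hne fun c hc => hf c (hseg hc)
  rw [hzw, sub_self, zero_div, zero_re] at hslope
  exact (hneg c (hseg hc)).ne' hslope

end MeanValue

section LogFeDelta

theorem exists_log_feDelta : ∃ φ : ℂ → ℂ, ∀ s : ℂ, 0 < s.re → 0 < s.im →
    exp (φ s) = feDelta s ∧ HasDerivAt φ (logDeriv feDelta s) s := by
  have hconvex : Convex ℝ {s : ℂ | 0 < s.re ∧ 0 < s.im} :=
    (convex_halfSpace_re_gt 0).inter (convex_halfSpace_im_gt 0)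
  have hopen : IsOpen {s : ℂ | 0 < s.re ∧ 0 < s.im} :=
    (isOpen_lt continuous_const continuous_re).inter (isOpen_lt continuous_const continuous_im)
  obtain ⟨φ, hφ⟩ := exists_hasDerivAt_log
    (isSimplyConnected_of_convex hconvex ⟨⟨1, 1⟩, one_pos, one_pos⟩) hopen
    (fun s hs => differentiableAt_feDelta hs.1 hs.2) (fun s hs => feDelta_ne_zero hs.2.ne')
  exact ⟨φ, fun s hre him => hφ s ⟨hre, him⟩⟩

/-- A branch of `log Δ`, holomorphic in the open first quadrant and unspecified elsewhere. -/
noncomputable def logFeDelta : ℂ → ℂ := exists_log_feDelta.choose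

theorem exp_logFeDelta {s : ℂ} (hre : 0 < s.re) (him : 0 < s.im) :
    exp (logFeDelta s) = feDelta s := (exists_log_feDelta.choose_spec s hre him).1

theorem hasDerivAt_logFeDelta {s : ℂ} (hre : 0 < s.re) (him : 0 < s.im) :
    HasDerivAt logFeDelta (logDeriv feDelta s) s := (exists_log_feDelta.choose_spec s hre him).2

theorem re_logFeDelta {s : ℂ} (hre : 0 < s.re) (him : 0 < s.im) :
    (logFeDelta s).re = Real.log ‖feDelta s‖ := by
  rw [← exp_logFeDelta hre him, norm_exp, Real.log_exp]

theorem two_le_log_div_two_pi {t : ℝ} (ht : 100 ≤ t) : 2 ≤ Real.log (t / (2 * Real.pi)) := by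
  have hexp : Real.exp 2 ≤ 9 := by
    rw [← one_add_one_eq_two, Real.exp_add]
    nlinarith [Real.exp_one_lt_d9, Real.exp_pos 1]
  rw [Real.le_log_iff_exp_le (by positivity), le_div_iff₀ Real.two_pi_pos]
  nlinarith [Real.pi_lt_d2, Real.pi_pos]

theorem re_logDeriv_feDelta_le_one_sub {s : ℂ} (hre : 0 < s.re) (him : 100 ≤ s.im) :
    (logDeriv feDelta s).re ≤ 1 - Real.log (s.im / (2 * Real.pi)) := by
  have hsmall : 5 / s.im ≤ 1 := by
    rw [div_le_one (by linarith)]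
    linarith
  linarith [re_logDeriv_feDelta_le hre (by linarith)]

theorem injOn_logFeDelta : Set.InjOn logFeDelta {s | 0 < s.re ∧ 100 ≤ s.im} :=
  injOn_of_re_deriv_neg ((convex_halfSpace_re_gt 0).inter (convex_halfSpace_im_ge 100))
    (fun s hs => hasDerivAt_logFeDelta hs.1 (by linarith [show 100 ≤ s.im from hs.2]))
    (fun _ hs => by
      linarith [re_logDeriv_feDelta_le_one_sub hs.1 hs.2, two_le_log_div_two_pi hs.2])

theorem log_norm_feDelta_le {s : ℂ} (hre : 1 / 2 ≤ s.re) (him : 100 ≤ s.im) :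
    Real.log ‖feDelta s‖ ≤ -((s.re - 1 / 2) * (Real.log (s.im / (2 * Real.pi)) - 1)) := by
  rcases hre.eq_or_lt with hre | hre
  · rw [norm_feDelta_eq_one hre.symm (by linarith), ← hre]
    simp
  let z : ℂ := ⟨1 / 2, s.im⟩
  have hzs : s - z = (s.re - 1 / 2 : ℝ) := Complex.ext (by simp [z]) (by simp [z])
  have hne : z ≠ s := fun h => hre.ne (congrArg re h)
  have hseg : segment ℝ z s ⊆ {c | 1 / 2 ≤ c.re ∧ c.im = s.im} :=
    ((convex_halfSpace_re_ge (1 / 2)).inter (convex_hyperplane imLm.isLinear s.im)).segment_subset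
      ⟨le_refl (1 / 2 : ℝ), rfl⟩ ⟨hre.le, rfl⟩
  obtain ⟨c, hc, hslope⟩ := exists_re_slope_eq_re_deriv hne fun c hc =>
    hasDerivAt_logFeDelta (by linarith [(hseg hc).1]) (by linarith [(hseg hc).2])
  obtain ⟨hcre, hcim⟩ := hseg hc
  have hderiv := re_logDeriv_feDelta_le_one_sub (s := c) (by linarith) (by linarith)
  have hz : (logFeDelta z).re = 0 := by
    rw [re_logFeDelta (s := z) (by norm_num [z]) (show 0 < s.im by linarith),
      norm_feDelta_eq_one (s := z) rfl (show s.im ≠ 0 by linarith), Real.log_one]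
  rw [← hslope, hzs, div_ofReal_re, sub_re, hz, sub_zero,
    re_logFeDelta (by linarith) (by linarith), hcim, div_le_iff₀ (by linarith)] at hderiv
  linarith

theorem abs_re_sub_half_mul_le {s : ℂ} (him : 100 ≤ s.im) :
    |s.re - 1 / 2| * (Real.log (s.im / (2 * Real.pi)) - 1) ≤ |Real.log ‖feDelta s‖| := by
  rcases le_total (1 / 2) s.re with hre | hre
  · rw [abs_of_nonneg (by linarith)]
    exact le_trans (by linarith [log_norm_feDelta_le hre him]) (neg_le_abs _)
  · have hreflect := congrArg Real.log (norm_feDelta_mul_norm (s := s) (by linarith))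
    have hre' : (1 - starRingEnd ℂ s).re = 1 - s.re := by simp
    have him' : (1 - starRingEnd ℂ s).im = s.im := by simp
    have hle := log_norm_feDelta_le (s := 1 - starRingEnd ℂ s) (by linarith) (by linarith)
    rw [Real.log_mul (norm_ne_zero_iff.2 (feDelta_ne_zero (by linarith)))
      (norm_ne_zero_iff.2 (feDelta_ne_zero (by linarith))), Real.log_one] at hreflect
    rw [hre', him'] at hle
    rw [abs_of_nonpos (by linarith)]
    exact le_trans (by linarith) (le_abs_self _)

theorem tendsto_log_div_two_pi :
    Tendsto (fun t : ℝ => Real.log (t / (2 * Real.pi))) atTop atTop :=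
  Real.tendsto_log_atTop.comp (tendsto_id.atTop_div_const Real.two_pi_pos)

theorem eventually_abs_re_sub_half_lt (a : ℂ) {ε : ℝ} (hε : 0 < ε) :
    ∀ᶠ T : ℝ in atTop, ∀ s : ℂ, T ≤ s.im → feDelta s = a → |s.re - 1 / 2| < ε := by
  have hlarge : ∀ᶠ t : ℝ in atTop,
      100 ≤ t ∧ |Real.log ‖a‖| / ε + 1 < Real.log (t / (2 * Real.pi)) :=
    (eventually_ge_atTop 100).and (tendsto_log_div_two_pi.eventually_gt_atTop _)
  filter_upwards [eventually_forall_ge_atTop.2 hlarge] with T hT s hTs hsa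
  obtain ⟨him, hlog⟩ := hT s.im hTs
  have hnonneg : 0 ≤ |Real.log ‖a‖| / ε := by positivity
  have hle := abs_re_sub_half_mul_le him
  have hlt : |Real.log ‖a‖| < ε * (Real.log (s.im / (2 * Real.pi)) - 1) := by
    rw [mul_comm, ← div_lt_iff₀ hε]
    linarith
  rw [hsa] at hle
  exact lt_of_mul_lt_mul_right (hle.trans_lt hlt) (by linarith)

theorem tendsto_re_of_feDelta_eq (a : ℂ) :
    Tendsto re (comap im atTop ⊓ 𝓟 {s : ℂ | feDelta s = a}) (𝓝 (1 / 2)) := by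
  refine Metric.tendsto_nhds.2 fun ε hε => ?_
  obtain ⟨T, hT⟩ := (eventually_abs_re_sub_half_lt a hε).exists
  filter_upwards [mem_inf_of_left (preimage_mem_comap (Ici_mem_atTop T)),
    mem_inf_of_right (mem_principal_self _)] with s hs hsa
  exact hT s hs hsa

end LogFeDelta

section LogarithmicGrowth

theorem isBigO_log_of_norm_deriv_le {E : Type*} [NormedAddCommGroup E] [NormedSpace ℝ E]
    {f f' : ℝ → E} {c : ℝ}
    (hf : ∀ᶠ t in atTop, HasDerivAt f (f' t) t ∧ ‖f' t‖ ≤ c / t) : f =O[atTop] Real.log := by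
  obtain ⟨A, hA, hfA⟩ := (atTop_basis' 1).eventually_iff.1 hf
  have hbound (t : ℝ) (ht : t ∈ Set.Ici A) :
      HasDerivAt (fun t => ‖f A‖ + c * (Real.log t - Real.log A)) (c * t⁻¹) t :=
    (((Real.hasDerivAt_log (one_pos.trans_le (hA.trans ht)).ne').sub_const _).const_mul c)
      |>.const_add _
  have hle (T : ℝ) (hT : A ≤ T) : ‖f T‖ ≤ ‖f A‖ + c * (Real.log T - Real.log A) :=
    image_norm_le_of_norm_deriv_right_le_deriv_boundary'
      (fun t ht => (hfA ht.1).1.continuousAt.continuousWithinAt)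
      (fun t ht => (hfA ht.1).1.hasDerivWithinAt) (by simp)
      (fun t ht => (hbound t ht.1).continuousAt.continuousWithinAt)
      (fun t ht => (hbound t ht.1).hasDerivWithinAt) (fun t ht => (hfA ht.1).2)
      (Set.right_mem_Icc.2 hT)
  have hO : (fun T => ‖f A‖ + c * (Real.log T - Real.log A)) =O[atTop] Real.log := by
    have hconst (C : ℝ) : (fun _ : ℝ => C) =O[atTop] Real.log :=
      Real.isLittleO_const_log_atTop.isBigO
    exact (hconst _).add (((isBigO_refl _ _).sub (hconst _)).const_mul_left c)
  refine IsBigO.trans (IsBigO.of_norm_eventuallyLE ?_) hO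
  filter_upwards [eventually_ge_atTop A] with T hT using hle T hT

end LogarithmicGrowth

section CriticalLine

/-- The argument of `Δ` along the upper half of the critical line, where `|Δ| = 1`. -/
noncomputable def criticalArg (t : ℝ) : ℝ := (logFeDelta ⟨1 / 2, t⟩).im

theorem logFeDelta_critical_line {t : ℝ} (ht : 0 < t) :
    logFeDelta ⟨1 / 2, t⟩ = criticalArg t * I := by
  refine Complex.ext ?_ (by simp [criticalArg])
  rw [re_logFeDelta one_half_pos ht, norm_feDelta_eq_one rfl ht.ne', Real.log_one]
  simp

theorem hasDerivAt_mk_im (σ t : ℝ) : HasDerivAt (fun t : ℝ => (⟨σ, t⟩ : ℂ)) I t := by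
  simpa [mk_eq_add_mul_I] using ((hasDerivAt_id t).ofReal_comp.mul_const I).const_add (σ : ℂ)

theorem hasDerivAt_criticalArg {t : ℝ} (ht : 0 < t) :
    HasDerivAt criticalArg (logDeriv feDelta ⟨1 / 2, t⟩).re t := by
  have hcomp := (hasDerivAt_logFeDelta (s := ⟨1 / 2, t⟩) one_half_pos ht).scomp t
    (hasDerivAt_mk_im (1 / 2) t)
  exact (imCLM.hasFDerivAt.comp_hasDerivAt t hcomp).congr_deriv (by simp)

theorem continuousOn_criticalArg : ContinuousOn criticalArg (Set.Ioi 0) := fun _ ht =>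
  (hasDerivAt_criticalArg ht).continuousAt.continuousWithinAt

theorem abs_deriv_criticalArg_add_log_le {t : ℝ} (ht : 2 ≤ t) :
    |(logDeriv feDelta ⟨1 / 2, t⟩).re + Real.log (t / (2 * Real.pi))| ≤ 6 / t := by
  have hle := norm_logDeriv_feDelta_add_log_le (s := ⟨1 / 2, t⟩) one_half_pos ht
  have habs := (abs_re_le_norm _).trans hle
  rw [add_re, ofReal_re] at habs
  exact habs.trans (by gcongr; norm_num)

/-- The main term of the counting formula, multiplied by `2π`. -/
noncomputable def mainTerm (t : ℝ) : ℝ := t * Real.log (t / (2 * Real.pi * Real.exp 1))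

theorem hasDerivAt_mainTerm {t : ℝ} (ht : 0 < t) :
    HasDerivAt mainTerm (Real.log (t / (2 * Real.pi))) t := by
  have hne : 2 * Real.pi * Real.exp 1 ≠ 0 := by positivity
  refine ((hasDerivAt_id t).mul
    (((hasDerivAt_id t).div_const (2 * Real.pi * Real.exp 1)).log
      (div_ne_zero ht.ne' hne))).congr_deriv ?_
  rw [id, ← div_div, Real.log_div (by positivity) (Real.exp_pos 1).ne', Real.log_exp]
  field_simp
  ring

theorem criticalArg_add_mainTerm_isBigO_log :
    (fun T => criticalArg T + mainTerm T) =O[atTop] Real.log := by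
  refine isBigO_log_of_norm_deriv_le (c := 6)
    (f' := fun t => (logDeriv feDelta ⟨1 / 2, t⟩).re + Real.log (t / (2 * Real.pi))) ?_
  filter_upwards [eventually_ge_atTop 2] with t ht
  exact ⟨(hasDerivAt_criticalArg (by linarith)).add (hasDerivAt_mainTerm (by linarith)),
    abs_deriv_criticalArg_add_log_le ht⟩

theorem deriv_criticalArg_le_neg_one {t : ℝ} (ht : 100 ≤ t) :
    (logDeriv feDelta ⟨1 / 2, t⟩).re ≤ -1 := by
  linarith [re_logDeriv_feDelta_le_one_sub (s := ⟨1 / 2, t⟩) one_half_pos ht,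
    two_le_log_div_two_pi ht]

theorem criticalArg_sub_le {t u : ℝ} (ht : 100 ≤ t) (htu : t ≤ u) :
    criticalArg u - criticalArg t ≤ t - u := by
  have hderiv (x : ℝ) (hx : 100 ≤ x) := hasDerivAt_criticalArg (t := x) (by linarith)
  have hle := (convex_Ici (100 : ℝ)).image_sub_le_mul_sub_of_deriv_le (C := -1)
    (fun x hx => (hderiv x hx).continuousAt.continuousWithinAt)
    (fun x hx => (hderiv x (interior_subset hx)).differentiableAt.differentiableWithinAt)
    (fun x hx => by
      rw [(hderiv x (interior_subset hx)).deriv]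
      exact deriv_criticalArg_le_neg_one (interior_subset hx))
    t ht u (ht.trans htu) htu
  linarith

theorem antitoneOn_criticalArg : AntitoneOn criticalArg (Set.Ici 100) := fun t ht u _ htu => by
  linarith [criticalArg_sub_le ht htu]

theorem criticalArg_sub_one_le {T : ℝ} (hT : 101 ≤ T) :
    criticalArg (T - 1) ≤ criticalArg T + Real.log T := by
  have hderiv (x : ℝ) (hx : 100 ≤ x) := hasDerivAt_criticalArg (t := x) (by linarith)
  obtain ⟨x, ⟨hx, hxT⟩, hslope⟩ := exists_hasDerivAt_eq_slope criticalArg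
    (fun x => (logDeriv feDelta ⟨1 / 2, x⟩).re) (sub_one_lt T)
    (fun x hx => (hderiv x (by linarith [hx.1])).continuousAt.continuousWithinAt)
    (fun x hx => hderiv x (by linarith [hx.1]))
  rw [sub_sub_cancel, div_one] at hslope
  have hx0 : 0 < x := by linarith
  have hlower := (abs_le.1 (abs_deriv_criticalArg_add_log_le (t := x) (by linarith))).1
  have hsmall : 6 / x ≤ 1 := by
    rw [div_le_one (by linarith)]
    linarith
  have hlog : Real.log (x / (2 * Real.pi)) + Real.log 6 ≤ Real.log T := by
    rw [← Real.log_mul (by positivity) (by norm_num)]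
    refine Real.log_le_log (by positivity) ?_
    rw [div_mul_eq_mul_div, div_le_iff₀ Real.two_pi_pos]
    nlinarith [Real.pi_gt_three]
  have hlog6 : 1 ≤ Real.log 6 :=
    (Real.le_log_iff_exp_le (by norm_num)).2 (by linarith [Real.exp_one_lt_d9])
  linarith

theorem abs_im_logFeDelta_sub_criticalArg_le {s : ℂ} (hre : 0 < s.re) (hre' : s.re ≤ 1)
    (him : 100 ≤ s.im) : |(logFeDelta s).im - criticalArg s.im| ≤ |s.re - 1 / 2| := by
  let S : Set ℂ := {z | 0 < z.re ∧ z.re ≤ 1 ∧ z.im = s.im}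
  let z : ℂ := ⟨1 / 2, s.im⟩
  let c := Real.log (s.im / (2 * Real.pi))
  have hS : Convex ℝ S := (convex_halfSpace_re_gt 0).inter
    ((convex_halfSpace_re_le 1).inter (convex_hyperplane imLm.isLinear s.im))
  have hz : z ∈ S := ⟨one_half_pos, one_half_lt_one.le, rfl⟩
  have hlip := hS.norm_image_sub_le_of_norm_hasDerivWithin_le (C := 1)
    (f := fun w => logFeDelta w + c * w)
    (fun w hw => ((hasDerivAt_logFeDelta hw.1 (by linarith [hw.2.2])).add
      ((hasDerivAt_id w).const_mul (c : ℂ))).hasDerivWithinAt)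
    (fun w hw => by
      obtain ⟨hwre, hwre', hwim⟩ := hw
      have hle := norm_logDeriv_feDelta_add_log_le (s := w) hwre (by linarith)
      rw [hwim] at hle
      rw [mul_one]
      refine hle.trans ?_
      rw [div_le_one (by linarith)]
      linarith)
    hz ⟨hre, hre', rfl⟩
  have hsz : s - z = (s.re - 1 / 2 : ℝ) := Complex.ext (by simp [z]) (by simp [z])
  rw [one_mul, hsz, norm_real, Real.norm_eq_abs] at hlip
  have him_eq : (logFeDelta s + c * s - (logFeDelta z + c * z)).im =
      (logFeDelta s).im - criticalArg s.im := by
    simp [criticalArg, z]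
  exact him_eq ▸ (abs_im_le_norm _).trans hlip

end CriticalLine

section Meromorphic

theorem finite_inter_preimage_singleton_of_meromorphic {𝕜 E : Type*} [RCLike 𝕜]
    [NormedAddCommGroup E] [NormedSpace 𝕜 E] {f : 𝕜 → E} (hf : Meromorphic f) {K : Set 𝕜}
    (hK : IsCompact K) {a : E} {z₀ : 𝕜} (hcont : ContinuousAt f z₀) (ha : f z₀ ≠ a) :
    (K ∩ f ⁻¹' {a}).Finite := by
  have hsub : Meromorphic fun z => f z - a := hf.sub (Meromorphic.const a)
  have hne : ∀ᶠ z in 𝓝[≠] z₀, f z - a ≠ 0 :=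
    ((hcont.eventually_ne ha).mono fun z hz => sub_ne_zero.2 hz).filter_mono nhdsWithin_le_nhds
  have horder := hsub.exists_meromorphicOrderAt_ne_top_iff_forall.1
    ⟨z₀, (meromorphicOrderAt_ne_top_iff_eventually_ne_zero (hsub z₀)).2 hne⟩
  by_contra hinf
  obtain ⟨z, -, hz⟩ := Set.Infinite.exists_accPt_of_subset_isCompact hinf hK Set.inter_subset_left
  obtain ⟨w, hw, hwa⟩ := ((accPt_iff_frequently_nhdsNE.1 hz).and_eventually
    ((meromorphicOrderAt_ne_top_iff_eventually_ne_zero (hsub z)).1 (horder z))).exists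
  exact hwa (sub_eq_zero.2 hw.2)

theorem meromorphic_feDelta : Meromorphic feDelta := by
  intro s
  have hpow (c : ℂ) (hc : c ≠ 0) : MeromorphicAt (fun z : ℂ => c ^ z) s :=
    (differentiable_id.const_cpow (Or.inl hc)).analyticAt s |>.meromorphicAt
  have hpow' : MeromorphicAt (fun z : ℂ => (Real.pi : ℂ) ^ (z - 1)) s :=
    ((differentiable_id.sub_const 1).const_cpow
      (Or.inl (ofReal_ne_zero.2 Real.pi_ne_zero))).analyticAt s |>.meromorphicAt
  have hGamma : MeromorphicAt (fun z => Gamma (1 - z)) s :=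
    (Meromorphic.Gamma (1 - s)).comp_analyticAt (g := fun z => 1 - z) (by fun_prop)
  have hsin : Differentiable ℂ fun z : ℂ => sin (Real.pi * z / 2) := by fun_prop
  exact (((hpow 2 two_ne_zero).mul hpow').mul hGamma).mul (hsin.analyticAt s).meromorphicAt

theorem continuousAt_feDelta_zero : ContinuousAt feDelta 0 := by
  have hGamma : ContinuousAt (fun z => Gamma (1 - z)) 0 :=
    (differentiableAt_Gamma _ (ne_neg_natCast_of_re_pos (by simp))).continuousAt.comp_of_eq
      (f := fun z => 1 - z) (by fun_prop) rfl
  have hpow (c : ℂ) (hc : c ≠ 0) : Continuous fun z : ℂ => c ^ z :=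
    continuous_id.const_cpow (Or.inl hc)
  have hpi : (Real.pi : ℂ) ≠ 0 := ofReal_ne_zero.2 Real.pi_ne_zero
  have hpow' : ContinuousAt (fun z : ℂ => (Real.pi : ℂ) ^ (z - 1)) 0 :=
    ((hpow _ hpi).comp (continuous_sub_right 1)).continuousAt
  have hsin : Continuous fun z : ℂ => sin (Real.pi * z / 2) := by fun_prop
  exact (((hpow 2 two_ne_zero).continuousAt.mul hpow').mul hGamma).mul hsin.continuousAt

theorem finite_inter_feDelta_eq {a : ℂ} (ha : a ≠ 0) {K : Set ℂ} (hK : IsCompact K) :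
    (K ∩ feDelta ⁻¹' {a}).Finite :=
  finite_inter_preimage_singleton_of_meromorphic meromorphic_feDelta hK continuousAt_feDelta_zero
    (by simpa [feDelta] using ha.symm)

end Meromorphic

section RightHalfPlane

theorem exists_log_Gammaℂ : ∃ φ : ℂ → ℂ, ∀ s : ℂ, 0 < s.re →
    exp (φ s) = Gammaℂ s ∧ HasDerivAt φ (logDeriv Gammaℂ s) s :=
  exists_hasDerivAt_log (isSimplyConnected_of_convex (convex_halfSpace_re_gt 0)
    ⟨1, show 0 < (1 : ℂ).re from one_pos⟩)
    (isOpen_lt continuous_const continuous_re) (fun _ hs => differentiableAt_Gammaℂ hs)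
    (fun _ hs => Gammaℂ_ne_zero hs)

theorem logDeriv_Gammaℂ_eq_log_add {s : ℂ} (hs : 0 < s.re) :
    logDeriv Gammaℂ s = log s - Real.log (2 * Real.pi) + digammaSubLog s := by
  rw [logDeriv_Gammaℂ hs, digammaSubLog]
  ring

theorem norm_digammaSubLog_le_one {s : ℂ} (hs : 100 ≤ s.re) : ‖digammaSubLog s‖ ≤ 1 := by
  have hnorm : 100 ≤ ‖s‖ := hs.trans (re_le_norm s)
  refine (norm_digammaSubLog_le (by linarith) (by linarith)).trans ?_
  rw [div_le_one (by linarith)]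
  linarith

theorem one_le_re_logDeriv_Gammaℂ {s : ℂ} (hs : 100 ≤ s.re) : 1 ≤ (logDeriv Gammaℂ s).re := by
  have hnorm : 100 ≤ ‖s‖ := hs.trans (re_le_norm s)
  have hlog := two_le_log_div_two_pi hnorm
  have hsub := neg_le_of_abs_le ((abs_re_le_norm _).trans (norm_digammaSubLog_le_one hs))
  rw [Real.log_div (by linarith) Real.two_pi_pos.ne'] at hlog
  rw [logDeriv_Gammaℂ_eq_log_add (by linarith), add_re, sub_re, log_re, ofReal_re]
  linarith

theorem norm_logDeriv_Gammaℂ_le {s : ℂ} (hs : 100 ≤ s.re) : ‖logDeriv Gammaℂ s‖ ≤ 2 * ‖s‖ := by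
  have hnorm : 100 ≤ ‖s‖ := hs.trans (re_le_norm s)
  have hlog : ‖log s‖ ≤ ‖s‖ + 3 := by
    refine (norm_le_abs_re_add_abs_im _).trans ?_
    rw [log_re, log_im, abs_of_nonneg (Real.log_nonneg (by linarith))]
    linarith [Real.log_le_sub_one_of_pos (show 0 < ‖s‖ by linarith), abs_arg_le_pi s,
      Real.pi_lt_d2]
  have hlog2pi : ‖(Real.log (2 * Real.pi) : ℂ)‖ ≤ 7 := by
    rw [norm_real, Real.norm_of_nonneg (Real.log_nonneg (by linarith [Real.pi_gt_three]))]
    linarith [Real.log_le_sub_one_of_pos Real.two_pi_pos, Real.pi_lt_d2]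
  rw [logDeriv_Gammaℂ_eq_log_add (by linarith)]
  linarith [norm_add_le (log s - Real.log (2 * Real.pi)) (digammaSubLog s),
    norm_sub_le (log s) (Real.log (2 * Real.pi)), norm_digammaSubLog_le_one hs]

theorem norm_Gammaℂ_mul_exp_le {s : ℂ} (hs : 100 < s.re) :
    ‖Gammaℂ ⟨100, s.im⟩‖ * Real.exp (s.re - 100) ≤ ‖Gammaℂ s‖ := by
  obtain ⟨φ, hφ⟩ := exists_log_Gammaℂ
  let z : ℂ := ⟨100, s.im⟩
  have hzs : s - z = (s.re - 100 : ℝ) := Complex.ext (by simp [z]) (by simp [z])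
  have hseg : segment ℝ z s ⊆ {c | 100 ≤ c.re} :=
    (convex_halfSpace_re_ge 100).segment_subset (le_refl (100 : ℝ)) hs.le
  obtain ⟨c, hc, hslope⟩ := exists_re_slope_eq_re_deriv (fun h => hs.ne (congrArg re h))
    fun c hc => (hφ c (by linarith [show 100 ≤ c.re from hseg hc])).2
  have hderiv := one_le_re_logDeriv_Gammaℂ (hseg hc)
  rw [← hslope, hzs, div_ofReal_re, sub_re, le_div_iff₀ (by linarith)] at hderiv
  rw [← (hφ s (by linarith)).1, ← (hφ z (by norm_num [z])).1, norm_exp, norm_exp, ← Real.exp_add,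
    Real.exp_le_exp]
  linarith

theorem eventually_mul_norm_le_norm_Gammaℂ {C : ℝ} (hC : 0 ≤ C) (T : ℝ) :
    ∀ᶠ x : ℝ in atTop, ∀ s : ℂ, x ≤ s.re → |s.im| ≤ T → C * ‖s‖ ≤ ‖Gammaℂ s‖ := by
  obtain ⟨m, hm, hmle⟩ : ∃ m > 0, ∀ t : ℝ, |t| ≤ T → m ≤ ‖Gammaℂ ⟨100, t⟩‖ := by
    have hcont : Continuous fun t : ℝ => ‖Gammaℂ ⟨100, t⟩‖ := continuous_iff_continuousAt.2 fun t =>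
      ((differentiableAt_Gammaℂ (s := ⟨100, t⟩) (by norm_num)).continuousAt.comp
        (hasDerivAt_mk_im 100 t).continuousAt).norm
    obtain ⟨m, hm, hmle⟩ := (isCompact_Icc (a := -T) (b := T)).exists_forall_le' hcont.continuousOn
      fun t _ => norm_pos_iff.2 (Gammaℂ_ne_zero (s := ⟨100, t⟩) (by norm_num))
    exact ⟨m, hm, fun t ht => hmle t (abs_le.1 ht)⟩
  have hexp := (Real.tendsto_mul_exp_add_div_pow_atTop (m * Real.exp (-100)) 0 1
    (by positivity)).eventually_ge_atTop (2 * C)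
  filter_upwards [eventually_forall_ge_atTop.2 hexp, eventually_ge_atTop T,
    eventually_gt_atTop 100] with x hx hxT hx100 s hs him
  have hre : 0 < s.re := by linarith
  have hnorm : ‖s‖ ≤ 2 * s.re := by
    refine (norm_le_abs_re_add_abs_im s).trans ?_
    rw [abs_of_pos hre]
    linarith
  have hgrowth := hx s.re hs
  rw [add_zero, pow_one, le_div_iff₀ hre] at hgrowth
  calc C * ‖s‖ ≤ 2 * C * s.re := by nlinarith
    _ ≤ m * Real.exp (-100) * Real.exp s.re := hgrowth
    _ = m * Real.exp (s.re - 100) := by rw [mul_assoc, ← Real.exp_add, neg_add_eq_sub]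
    _ ≤ ‖Gammaℂ ⟨100, s.im⟩‖ * Real.exp (s.re - 100) := by gcongr; exact hmle _ him
    _ ≤ ‖Gammaℂ s‖ := norm_Gammaℂ_mul_exp_le (by linarith)

theorem Gammaℂ_ofReal_im (x : ℝ) : (Gammaℂ x).im = 0 := by
  rw [← conj_eq_iff_im, ← Gammaℂ_conj, conj_ofReal]

theorem abs_im_Gammaℂ_le {s : ℂ} (hs : 100 ≤ s.re) :
    |(Gammaℂ s).im| ≤ ‖Gammaℂ s‖ * (2 * ‖s‖ * |s.im|) := by
  obtain ⟨φ, hφ⟩ := exists_log_Gammaℂ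
  have hmem : (s.re : ℂ) ∈ {z : ℂ | 100 ≤ z.re} ∩ Metric.closedBall 0 ‖s‖ :=
    ⟨hs, by simpa using abs_re_le_norm s⟩
  have hlip := ((convex_halfSpace_re_ge 100).inter
    (convex_closedBall 0 ‖s‖)).norm_image_sub_le_of_norm_hasDerivWithin_le (C := 2 * ‖s‖)
    (fun z hz => (hφ z (by linarith [show 100 ≤ z.re from hz.1])).2.hasDerivWithinAt)
    (fun z hz => (norm_logDeriv_Gammaℂ_le hz.1).trans
      (mul_le_mul_of_nonneg_left (mem_closedBall_zero_iff.1 hz.2) zero_le_two))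
    hmem ⟨hs, by simp⟩
  have hsub : s - s.re = s.im * I := by
    rw [sub_eq_iff_eq_add']
    exact (re_add_im s).symm
  rw [hsub, norm_mul, norm_I, mul_one, norm_real, Real.norm_eq_abs] at hlip
  have hfactor : Gammaℂ s = (Gammaℂ s.re).re * exp (φ s - φ s.re) := by
    have hreal : ((Gammaℂ s.re).re : ℂ) = Gammaℂ s.re := Complex.ext rfl (Gammaℂ_ofReal_im _).symm
    rw [hreal, ← (hφ s (by linarith)).1, ← (hφ s.re (show 0 < s.re by linarith)).1, ← exp_add,
      add_sub_cancel]
  have hnorm : ‖Gammaℂ s‖ = |(Gammaℂ s.re).re| * Real.exp (φ s - φ s.re).re := by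
    rw [hfactor, norm_mul, norm_real, Real.norm_eq_abs, norm_exp]
  have him : (Gammaℂ s).im =
      (Gammaℂ s.re).re * (Real.exp (φ s - φ s.re).re * Real.sin (φ s - φ s.re).im) := by
    rw [hfactor, im_ofReal_mul, exp_im]
  rw [him, hnorm, ← mul_assoc, abs_mul, abs_mul, Real.abs_exp]
  gcongr
  exact Real.abs_sin_le_abs.trans ((abs_im_le_norm _).trans hlip)

end RightHalfPlane

section Finiteness

theorem norm_mul_norm_Gammaℂ_mul_norm_cos {a s : ℂ} (ha : a ≠ 0) (hs : s.im ≠ 0)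
    (hsa : feDelta s = a) : ‖a‖ * ‖Gammaℂ s‖ * ‖cos (Real.pi * s / 2)‖ = 1 := by
  rw [mul_assoc, ← norm_mul, ← norm_mul, ← inv_inv (Gammaℂ s * _), ← feDelta_eq_inv hs, hsa,
    mul_inv_cancel₀ ha, norm_one]

theorem pi_mul_div_two_re (s : ℂ) : (Real.pi * s / 2).re = Real.pi * s.re / 2 := by simp

theorem pi_mul_div_two_im (s : ℂ) : (Real.pi * s / 2).im = Real.pi * s.im / 2 := by simp

theorem im_le_norm_cos_pi_mul_div_two {s : ℂ} (hs : 0 ≤ s.im) :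
    s.im ≤ ‖cos (Real.pi * s / 2)‖ := by
  have hle : s.im ≤ (Real.pi * s / 2).im := by
    rw [pi_mul_div_two_im]
    nlinarith [Real.pi_gt_three]
  exact hle.trans (im_le_norm_cos (hs.trans hle))

theorem im_le_two_mul_abs_im_cos {s : ℂ} (hs : 0 ≤ s.im)
    (hcos : ‖cos (Real.pi * s / 2)‖ ≤ 1 / 2) : s.im ≤ 2 * |(cos (Real.pi * s / 2)).im| := by
  have him : (cos (Real.pi * s / 2)).im =
      -(Real.sin (Real.pi * s.re / 2) * Real.sinh (Real.pi * s.im / 2)) := by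
    rw [Complex.cos_eq, pi_mul_div_two_re, pi_mul_div_two_im, ← ofReal_cos, ← ofReal_cosh,
      ← ofReal_sin, ← ofReal_sinh, ← ofReal_mul, ← ofReal_mul, sub_im, ofReal_im, im_ofReal_mul,
      I_im, mul_one, zero_sub]
  have hsinh : s.im ≤ Real.sinh (Real.pi * s.im / 2) :=
    le_trans (by nlinarith [Real.pi_gt_three]) (Real.self_le_sinh_iff.2 (by positivity))
  have hsin : 1 / 2 ≤ |Real.sin (Real.pi * s.re / 2)| := by
    have hsq := norm_cos_sq (Real.pi * s / 2)
    rw [pi_mul_div_two_re] at hsq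
    refine (le_abs_self _).trans (sq_le_sq.1 ?_)
    nlinarith [norm_nonneg (cos (Real.pi * s / 2)), sq_nonneg (Real.sinh (Real.pi * s / 2 : ℂ).im),
      Real.sin_sq_add_cos_sq (Real.pi * s.re / 2)]
  rw [him, abs_neg, abs_mul, abs_of_nonneg (hs.trans hsinh)]
  nlinarith

theorem eventually_feDelta_ne_of_le_im {a : ℂ} (ha : a ≠ 0) {t₀ : ℝ} (ht₀ : 0 < t₀) (T : ℝ) :
    ∀ᶠ x : ℝ in atTop, ∀ s : ℂ, x ≤ s.re → t₀ ≤ s.im → s.im ≤ T → feDelta s ≠ a := by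
  have : 0 < ‖a‖ := norm_pos_iff.2 ha
  filter_upwards [eventually_mul_norm_le_norm_Gammaℂ (C := (‖a‖ * t₀)⁻¹) (by positivity) T,
    eventually_gt_atTop 1] with x hx hx1 s hs him him' hsa
  have hGamma := hx s hs (abs_le.2 ⟨by linarith, him'⟩)
  have hcos := im_le_norm_cos_pi_mul_div_two (s := s) (by linarith)
  have hnorm : 1 < ‖s‖ := (hx1.trans_le hs).trans_le (re_le_norm s)
  rw [inv_mul_le_iff₀ (by positivity)] at hGamma
  have hone := norm_mul_norm_Gammaℂ_mul_norm_cos ha (by linarith) hsa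
  have hle : ‖a‖ * ‖Gammaℂ s‖ * t₀ ≤ ‖a‖ * ‖Gammaℂ s‖ * ‖cos (Real.pi * s / 2)‖ := by
    gcongr
    exact him.trans hcos
  linarith

theorem eventually_feDelta_ne_of_im_eq_zero {a : ℂ} (ha : a ≠ 0) (hreal : a.im = 0) (T : ℝ) :
    ∀ᶠ x : ℝ in atTop, ∀ s : ℂ, x ≤ s.re → 0 < s.im → s.im ≤ T → feDelta s ≠ a := by
  have ha' : 0 < ‖a‖ := norm_pos_iff.2 ha
  filter_upwards [eventually_mul_norm_le_norm_Gammaℂ (C := 5 / ‖a‖) (by positivity) T,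
    eventually_ge_atTop 100] with x hx hx100 s hs him him' hsa
  have hGamma := hx s hs (abs_le.2 ⟨by linarith, him'⟩)
  have hnorm : 100 ≤ ‖s‖ := (hx100.trans hs).trans (re_le_norm s)
  rw [div_mul_eq_mul_div, div_le_iff₀' ha'] at hGamma
  have hone := norm_mul_norm_Gammaℂ_mul_norm_cos ha him.ne' hsa
  have hcos : ‖cos (Real.pi * s / 2)‖ ≤ 1 / 2 := by
    nlinarith [norm_nonneg (cos (Real.pi * s / 2))]
  have hprod : (a.re : ℂ) * cos (Real.pi * s / 2) = (Gammaℂ s)⁻¹ := by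
    rw [show (a.re : ℂ) = a from Complex.ext rfl hreal.symm, ← hsa, feDelta_eq_inv him.ne', mul_inv,
      mul_assoc, inv_mul_cancel₀ (cos_pi_mul_div_two_ne_zero him), mul_one]
  have hnormGamma : 0 < ‖Gammaℂ s‖ := norm_pos_iff.2 (Gammaℂ_ne_zero (by linarith))
  have hnorma : ‖a‖ = |a.re| := (abs_re_eq_norm.2 hreal).symm
  have himprod : ‖a‖ * |(cos (Real.pi * s / 2)).im| * ‖Gammaℂ s‖ ^ 2 = |(Gammaℂ s).im| := by
    rw [hnorma, ← abs_mul, ← im_ofReal_mul, hprod, inv_im, normSq_eq_norm_sq, abs_div, abs_neg,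
      abs_of_pos (sq_pos_of_pos hnormGamma), div_mul_cancel₀ _ (sq_pos_of_pos hnormGamma).ne']
  have hle : ‖a‖ * ‖Gammaℂ s‖ * (s.im * ‖Gammaℂ s‖) ≤ 4 * ‖s‖ * (s.im * ‖Gammaℂ s‖) :=
    calc ‖a‖ * ‖Gammaℂ s‖ * (s.im * ‖Gammaℂ s‖) = ‖a‖ * s.im * ‖Gammaℂ s‖ ^ 2 := by ring
      _ ≤ ‖a‖ * (2 * |(cos (Real.pi * s / 2)).im|) * ‖Gammaℂ s‖ ^ 2 := by
        gcongr
        exact im_le_two_mul_abs_im_cos him.le hcos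
      _ = 2 * |(Gammaℂ s).im| := by rw [← himprod]; ring
      _ ≤ 2 * (‖Gammaℂ s‖ * (2 * ‖s‖ * |s.im|)) := by
        gcongr
        exact abs_im_Gammaℂ_le (hx100.trans hs)
      _ = 4 * ‖s‖ * (s.im * ‖Gammaℂ s‖) := by rw [abs_of_pos him]; ring
  linarith [le_of_mul_le_mul_right hle (by positivity)]

theorem finite_aPoints {a : ℂ} (ha : a ≠ 0) {t₀ : ℝ} (ht₀ : 0 ≤ t₀) {B : EReal}
    (h : 0 < t₀ ∨ B < ⊤ ∨ a.im = 0) (T : ℝ) : (aPoints a t₀ B T).Finite := by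
  obtain ⟨b, hb⟩ : ∃ b : ℝ, ∀ s ∈ aPoints a t₀ B T, s.re ≤ b := by
    rcases h with ht₀' | hB | hreal
    · obtain ⟨b, hb⟩ := (eventually_feDelta_ne_of_le_im ha ht₀' T).exists
      exact ⟨b, fun s ⟨hsa, _, _, him, him'⟩ =>
        le_of_not_ge fun hre => hb s hre him.le him'.le hsa⟩
    · obtain ⟨b, hBb, -⟩ := EReal.lt_iff_exists_real_btwn.1 hB
      exact ⟨b, fun s ⟨_, _, hre, _, _⟩ => EReal.coe_le_coe_iff.1 (hre.trans hBb).le⟩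
    · obtain ⟨b, hb⟩ := (eventually_feDelta_ne_of_im_eq_zero ha hreal T).exists
      exact ⟨b, fun s ⟨hsa, _, _, him, him'⟩ =>
        le_of_not_ge fun hre => hb s hre (ht₀.trans_lt him) him'.le hsa⟩
  refine (finite_inter_feDelta_eq ha
    (isCompact_Icc (a := -1) (b := b) |>.reProdIm (isCompact_Icc (a := t₀) (b := T)))).subset ?_
  intro s hs
  exact ⟨⟨⟨hs.2.1.le, hb s hs⟩, hs.2.2.2.1.le, hs.2.2.2.2.le⟩, hs.1⟩

end Finiteness

section Surjectivity

theorem surjOn_closedBall_of_norm_deriv_sub_le {𝕜 : Type*} [RCLike 𝕜] {f f' : 𝕜 → 𝕜} {c z₀ : 𝕜}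
    {K : NNReal} {ρ : ℝ} (hρ : 0 ≤ ρ) (hc : c ≠ 0)
    (hf : ∀ z ∈ Metric.closedBall z₀ ρ, HasDerivAt f (f' z) z ∧ ‖f' z - c‖ ≤ K) :
    Set.SurjOn f (Metric.closedBall z₀ ρ) (Metric.closedBall (f z₀) ((‖c‖ - K) * ρ)) := by
  have happrox : ApproximatesLinearOn f (c • ContinuousLinearMap.id 𝕜 𝕜)
      (Metric.closedBall z₀ ρ) K := by
    intro x hx y hy
    have hlip := (convex_closedBall z₀ ρ).norm_image_sub_le_of_norm_hasDerivWithin_le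
      (f := fun z => f z - c * z)
      (fun z hz => ((hf z hz).1.sub ((hasDerivAt_id z).const_mul c)).hasDerivWithinAt)
      (fun z hz => by simpa using (hf z hz).2) hy hx
    convert hlip using 2
    simp only [smul_apply, ContinuousLinearMap.id_apply, smul_eq_mul]
    ring
  let R : (c • ContinuousLinearMap.id 𝕜 𝕜).NonlinearRightInverse :=
    { toFun := fun y => c⁻¹ * y
      nnnorm := ‖c‖₊⁻¹
      bound' := fun y => by simp
      right_inv' := fun y => by simp [hc] }
  simpa [R] using happrox.surjOn_closedBall_of_nonlinearRightInverse R hρ subset_rfl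

end Surjectivity

section Counting

theorem abs_ncard_intCast_preimage_Icc_sub_le {x y : ℝ} (hxy : x ≤ y) :
    |((Int.cast ⁻¹' Set.Icc x y : Set ℤ).ncard : ℝ) - (y - x)| ≤ 1 := by
  have hcard : (Int.cast ⁻¹' Set.Icc x y : Set ℤ).ncard = (⌊y⌋ + 1 - ⌈x⌉).toNat := by
    rw [Int.preimage_Icc, ← Finset.coe_Icc, Set.ncard_coe_finset, Int.card_Icc]
  have hnonneg : 0 ≤ ⌊y⌋ + 1 - ⌈x⌉ := by
    have hlt : ⌈x⌉ < ⌊y⌋ + 2 := Int.ceil_lt_iff.2 (by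
      push_cast
      linarith [Int.lt_floor_add_one y])
    lia
  have hcast : ((⌊y⌋ + 1 - ⌈x⌉).toNat : ℝ) = ⌊y⌋ + 1 - ⌈x⌉ := by
    exact_mod_cast congrArg (Int.cast : ℤ → ℝ) (Int.toNat_of_nonneg hnonneg)
  rw [hcard, hcast, abs_le]
  constructor <;> linarith [Int.floor_le y, Int.lt_floor_add_one y, Int.le_ceil x,
    Int.ceil_lt_add_one x]

/-- The integer `n` for which `log Δ(s) = log a + 2πin` at an `a`-point `s` of `Δ`; the rounding
only serves to make it an integer at every `s`. -/
noncomputable def branchIndex (a s : ℂ) : ℤ :=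
  round (((logFeDelta s).im - a.arg) / (2 * Real.pi))

theorem branchIndex_eq {a s : ℂ} {n : ℤ} (h : logFeDelta s = log a + n * (2 * Real.pi * I)) :
    branchIndex a s = n := by
  have him : (logFeDelta s).im = a.arg + n * (2 * Real.pi) := by
    rw [h, add_im, log_im]
    simp
  rw [branchIndex, him, add_sub_cancel_left, mul_div_cancel_right₀ _ Real.two_pi_pos.ne',
    round_intCast]

theorem logFeDelta_eq_log_add_branchIndex {a s : ℂ} (ha : a ≠ 0) (hre : 0 < s.re) (him : 0 < s.im)
    (hsa : feDelta s = a) :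
    logFeDelta s = log a + branchIndex a s * (2 * Real.pi * I) := by
  obtain ⟨n, hn⟩ := exp_eq_exp_iff_exists_int.1
    (((exp_logFeDelta hre him).trans hsa).trans (exp_log ha).symm)
  rw [branchIndex_eq hn, hn]

theorem im_logFeDelta_eq_arg_add {a s : ℂ} (ha : a ≠ 0) (hre : 0 < s.re) (him : 0 < s.im)
    (hsa : feDelta s = a) :
    (logFeDelta s).im = a.arg + branchIndex a s * (2 * Real.pi) := by
  rw [logFeDelta_eq_log_add_branchIndex ha hre him hsa, add_im, log_im]
  simp

theorem injOn_branchIndex {a : ℂ} (ha : a ≠ 0) :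
    Set.InjOn (branchIndex a) {s | 0 < s.re ∧ 100 ≤ s.im ∧ feDelta s = a} := by
  rintro s ⟨hre, him, hsa⟩ s' ⟨hre', him', hsa'⟩ heq
  refine injOn_logFeDelta ⟨hre, him⟩ ⟨hre', him'⟩ ?_
  rw [logFeDelta_eq_log_add_branchIndex ha hre (by linarith) hsa, heq,
    logFeDelta_eq_log_add_branchIndex ha hre' (by linarith) hsa']

theorem eventually_injOn_branchIndex {a : ℂ} (ha : a ≠ 0) (B : EReal) :
    ∀ᶠ T₀ : ℝ in atTop, ∀ T, Set.InjOn (branchIndex a) (aPoints a T₀ B T) := by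
  filter_upwards [eventually_abs_re_sub_half_lt a one_half_pos, eventually_ge_atTop 100]
    with T₀ hclose hT₀ T
  refine Set.InjOn.mono ?_ (injOn_branchIndex ha)
  rintro s ⟨hsa, -, -, him, -⟩
  have hre := (abs_lt.1 (hclose s him.le hsa)).1
  exact ⟨by linarith, hT₀.trans him.le, hsa⟩

theorem eventually_mapsTo_branchIndex {a : ℂ} (ha : a ≠ 0) (B : EReal) :
    ∀ᶠ T₀ : ℝ in atTop, ∀ T, T₀ ≤ T →
      Set.MapsTo (branchIndex a) (aPoints a T₀ B T)
        (Int.cast ⁻¹' Set.Icc ((criticalArg T - 1 / 2 - a.arg) / (2 * Real.pi))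
          ((criticalArg T₀ + 1 / 2 - a.arg) / (2 * Real.pi))) := by
  filter_upwards [eventually_abs_re_sub_half_lt a one_half_pos, eventually_ge_atTop 100]
    with T₀ hclose hT₀ T hT
  rintro s ⟨hsa, -, -, him, him'⟩
  have hs100 : 100 ≤ s.im := hT₀.trans him.le
  have hre := hclose s him.le hsa
  have hre' := abs_lt.1 hre
  have hre0 : 0 < s.re := by linarith [hre'.1]
  have hindex := im_logFeDelta_eq_arg_add ha hre0 (by linarith) hsa
  have harg := abs_le.1 ((abs_im_logFeDelta_sub_criticalArg_le hre0 (by linarith [hre'.2])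
    hs100).trans hre.le)
  have hlower : criticalArg T ≤ criticalArg s.im :=
    antitoneOn_criticalArg hs100 (hT₀.trans hT) him'.le
  have hupper : criticalArg s.im ≤ criticalArg T₀ := antitoneOn_criticalArg hT₀ hs100 him.le
  constructor
  · rw [div_le_iff₀ Real.two_pi_pos]
    linarith [harg.1]
  · rw [le_div_iff₀ Real.two_pi_pos]
    linarith [harg.2]

theorem eventually_ncard_aPoints_le {a : ℂ} (ha : a ≠ 0) (B : EReal) :
    ∀ᶠ T₀ : ℝ in atTop, ∀ T, T₀ ≤ T →
      2 * Real.pi * (aPoints a T₀ B T).ncard ≤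
        criticalArg T₀ - criticalArg T + (1 + 2 * Real.pi) := by
  filter_upwards [eventually_injOn_branchIndex ha B, eventually_mapsTo_branchIndex ha B,
    eventually_ge_atTop 100] with T₀ hinj hmaps hT₀ T hT
  have hanti : criticalArg T ≤ criticalArg T₀ := antitoneOn_criticalArg hT₀ (hT₀.trans hT) hT
  have hpi := Real.two_pi_pos
  have hcard := Nat.cast_le (α := ℝ).2 (Set.ncard_le_ncard_of_injOn _ (hmaps T hT) (hinj T)
    (by rw [Int.preimage_Icc]; exact Set.finite_Icc _ _))
  have hcount := (abs_le.1 (abs_ncard_intCast_preimage_Icc_sub_le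
    (div_le_div_of_nonneg_right (sub_le_sub_right
      (show criticalArg T - 1 / 2 ≤ criticalArg T₀ + 1 / 2 by linarith) a.arg) hpi.le))).2
  rw [← sub_div, sub_sub_sub_cancel_right] at hcount
  have hlength : (aPoints a T₀ B T).ncard - 1 ≤
      (criticalArg T₀ + 1 / 2 - (criticalArg T - 1 / 2)) / (2 * Real.pi) := by linarith
  rw [le_div_iff₀ hpi] at hlength
  linarith

theorem abs_log_sub_log_le {m x y : ℝ} (hm : 0 < m) (hx : m ≤ x) (hy : m ≤ y) :
    |Real.log x - Real.log y| ≤ |x - y| / m := by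
  have hmvt := (convex_Ici m).norm_image_sub_le_of_norm_hasDerivWithin_le (f := Real.log)
    (f' := (·⁻¹)) (C := m⁻¹)
    (fun z hz => (Real.hasDerivAt_log (hm.trans_le hz).ne').hasDerivWithinAt)
    (fun z hz => by
      rw [norm_inv, Real.norm_of_nonneg (hm.le.trans hz)]
      exact inv_anti₀ hm hz) hy hx
  rwa [Real.norm_eq_abs, Real.norm_eq_abs, ← div_eq_inv_mul] at hmvt

theorem norm_logDeriv_feDelta_add_log_le_one {s : ℂ} {t : ℝ} (ht : 101 ≤ t) (hre : 0 < s.re)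
    (hre' : s.re ≤ 1) (him : |s.im - t| ≤ 1 / 4) :
    ‖logDeriv feDelta s + Real.log (t / (2 * Real.pi))‖ ≤ 1 := by
  have hhigh : 100 ≤ s.im := by linarith [(abs_le.1 him).1]
  have hle : ‖logDeriv feDelta s + Real.log (s.im / (2 * Real.pi))‖ ≤ 1 / 2 := by
    refine (norm_logDeriv_feDelta_add_log_le hre (by linarith)).trans ?_
    rw [div_le_iff₀ (by linarith)]
    linarith
  have hlog : |Real.log t - Real.log s.im| ≤ 1 / 2 := by
    refine (abs_log_sub_log_le (m := 100) (by norm_num) (by linarith) hhigh).trans ?_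
    rw [abs_sub_comm]
    linarith
  have hsplit : logDeriv feDelta s + Real.log (t / (2 * Real.pi)) =
      logDeriv feDelta s + Real.log (s.im / (2 * Real.pi)) +
        (Real.log t - Real.log s.im : ℝ) := by
    rw [Real.log_div (by linarith) Real.two_pi_pos.ne',
      Real.log_div (by linarith) Real.two_pi_pos.ne']
    push_cast
    ring
  rw [hsplit]
  refine (norm_add_le_of_le hle ?_).trans_eq (add_halves 1)
  rwa [norm_real]

theorem surjOn_logFeDelta_closedBall {t ρ : ℝ} (ht : 101 ≤ t) (hρ : 0 ≤ ρ) (hρ' : ρ ≤ 1 / 4) :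
    Set.SurjOn logFeDelta (Metric.closedBall ⟨1 / 2, t⟩ ρ)
      (Metric.closedBall (criticalArg t * I) ((Real.log (t / (2 * Real.pi)) - 1) * ρ)) := by
  have hlog := two_le_log_div_two_pi (t := t) (by linarith)
  have hderiv (s : ℂ) (hs : s ∈ Metric.closedBall (⟨1 / 2, t⟩ : ℂ) ρ) :
      HasDerivAt logFeDelta (logDeriv feDelta s) s ∧
        ‖logDeriv feDelta s - -Real.log (t / (2 * Real.pi))‖ ≤ (1 : NNReal) := by
    have hdist := (mem_closedBall_iff_norm.1 hs).trans hρ'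
    have hre := abs_le.1 ((abs_re_le_norm (s - ⟨1 / 2, t⟩)).trans hdist)
    have him := (abs_im_le_norm (s - ⟨1 / 2, t⟩)).trans hdist
    rw [sub_re] at hre
    have hre0 : 0 < s.re := by linarith [hre.1]
    rw [sub_neg_eq_add]
    exact ⟨hasDerivAt_logFeDelta hre0 (by linarith [(abs_le.1 him).1, sub_im s ⟨1 / 2, t⟩]),
      norm_logDeriv_feDelta_add_log_le_one ht hre0 (by linarith [hre.2]) him⟩
  have hsurj := surjOn_closedBall_of_norm_deriv_sub_le hρ
    (neg_ne_zero.2 (ofReal_ne_zero.2 (by linarith))) hderiv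
  rwa [logFeDelta_critical_line (by linarith), norm_neg, norm_real,
    Real.norm_of_nonneg (by linarith), NNReal.coe_one] at hsurj

theorem eventually_exists_feDelta_eq {a : ℂ} (ha : a ≠ 0) {ρ : ℝ} (hρ : 0 < ρ) :
    ∀ᶠ t : ℝ in atTop, ∀ n : ℤ, criticalArg t = a.arg + n * (2 * Real.pi) →
      ∃ s : ℂ, |s.re - 1 / 2| ≤ ρ ∧ |s.im - t| < 1 ∧ feDelta s = a ∧ branchIndex a s = n := by
  let r := min ρ (1 / 4)
  have hr : 0 < r := lt_min hρ (by norm_num)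
  filter_upwards [eventually_ge_atTop 101,
    tendsto_log_div_two_pi.eventually_ge_atTop (|Real.log ‖a‖| / r + 1)] with t ht hlog n hn
  have hmem : log a + n * (2 * Real.pi * I) ∈ Metric.closedBall (criticalArg t * I)
      ((Real.log (t / (2 * Real.pi)) - 1) * r) := by
    have hsub : log a + n * (2 * Real.pi * I) - criticalArg t * I = Real.log ‖a‖ := by
      rw [hn, Complex.log]
      push_cast
      ring
    rw [mem_closedBall_iff_norm, hsub, norm_real, Real.norm_eq_abs, ← div_le_iff₀ hr]
    linarith
  obtain ⟨s, hs, hslog⟩ := surjOn_logFeDelta_closedBall ht hr.le (min_le_right _ _) hmem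
  have hdist := mem_closedBall_iff_norm.1 hs
  have hre : |s.re - 1 / 2| ≤ r := (abs_re_le_norm (s - ⟨1 / 2, t⟩)).trans hdist
  have him : |s.im - t| ≤ r := (abs_im_le_norm (s - ⟨1 / 2, t⟩)).trans hdist
  have hr4 : r ≤ 1 / 4 := min_le_right _ _
  refine ⟨s, hre.trans (min_le_left _ _), by linarith, ?_, branchIndex_eq hslog⟩
  rw [← exp_logFeDelta (by linarith [(abs_le.1 hre).1]) (by linarith [(abs_le.1 him).1]),
    exp_eq_exp_iff_exists_int.2 ⟨n, hslog⟩, exp_log ha]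

theorem eventually_surjOn_branchIndex {a : ℂ} (ha : a ≠ 0) {B : EReal}
    (hB : ((1 / 2 : ℝ) : EReal) < B) : ∀ᶠ T₀ : ℝ in atTop, ∀ T, T₀ + 2 ≤ T →
      Set.SurjOn (branchIndex a) (aPoints a T₀ B T)
        (Int.cast ⁻¹' Set.Icc ((criticalArg (T - 1) - a.arg) / (2 * Real.pi))
          ((criticalArg (T₀ + 1) - a.arg) / (2 * Real.pi))) := by
  obtain ⟨b, hb, hbB⟩ := EReal.lt_iff_exists_real_btwn.1 hB
  rw [EReal.coe_lt_coe_iff] at hb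
  have hρ : 0 < min (b - 1 / 2) 1 := lt_min (by linarith) one_pos
  filter_upwards [eventually_forall_ge_atTop.2 (eventually_exists_feDelta_eq ha hρ),
    eventually_ge_atTop 0] with T₀ hsolve hT₀ T hT n hn
  obtain ⟨hlower, hupper⟩ := hn
  rw [div_le_iff₀ Real.two_pi_pos] at hlower
  rw [le_div_iff₀ Real.two_pi_pos] at hupper
  obtain ⟨t, ht, htn⟩ := intermediate_value_Icc' (show T₀ + 1 ≤ T - 1 by linarith)
    (continuousOn_criticalArg.mono fun t ht => show 0 < t by linarith [ht.1])
    (show a.arg + n * (2 * Real.pi) ∈ _ from ⟨by linarith, by linarith⟩)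
  obtain ⟨s, hre, him, hsa, hindex⟩ := hsolve t (by linarith [ht.1]) n htn
  have hre' := abs_le.1 hre
  have him' := abs_lt.1 him
  have hreb : s.re ≤ b := by linarith [hre'.2, min_le_left (b - 1 / 2) 1]
  exact ⟨s, ⟨hsa, by linarith [hre'.1, min_le_right (b - 1 / 2) 1],
    (EReal.coe_le_coe_iff.2 hreb).trans_lt hbB, by linarith [ht.1, him'.1],
    by linarith [ht.2, him'.2]⟩, hindex⟩

theorem eventually_le_ncard_aPoints {a : ℂ} (ha : a ≠ 0) {B : EReal}
    (hB : ((1 / 2 : ℝ) : EReal) < B) : ∀ᶠ T₀ : ℝ in atTop, ∀ T, T₀ + 2 ≤ T →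
      criticalArg (T₀ + 1) - criticalArg (T - 1) - 2 * Real.pi ≤
        2 * Real.pi * (aPoints a T₀ B T).ncard := by
  filter_upwards [eventually_surjOn_branchIndex ha hB, eventually_ge_atTop 100]
    with T₀ hsurj hT₀ T hT
  have hfin : (aPoints a T₀ B T).Finite := finite_aPoints ha (by linarith) (Or.inl (by linarith)) T
  have hanti : criticalArg (T - 1) ≤ criticalArg (T₀ + 1) :=
    antitoneOn_criticalArg (show 100 ≤ T₀ + 1 by linarith) (show 100 ≤ T - 1 by linarith)
      (by linarith)
  have hpi := Real.two_pi_pos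
  have hcard := Nat.cast_le (α := ℝ).2
    ((Set.ncard_le_ncard (hsurj T hT) (hfin.image _)).trans (Set.ncard_image_le hfin))
  have hcount := (abs_le.1 (abs_ncard_intCast_preimage_Icc_sub_le
    (div_le_div_of_nonneg_right (sub_le_sub_right hanti a.arg) hpi.le))).1
  rw [← sub_div, sub_sub_sub_cancel_right] at hcount
  have hlength : (criticalArg (T₀ + 1) - criticalArg (T - 1)) / (2 * Real.pi) ≤
      (aPoints a T₀ B T).ncard + 1 := by linarith
  rw [div_le_iff₀ hpi] at hlength
  linarith

theorem eventually_ncard_aPoints_add_criticalArg_isBigO_log {a : ℂ} (ha : a ≠ 0) {B : EReal}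
    (hB : ((1 / 2 : ℝ) : EReal) < B) : ∀ᶠ T₀ : ℝ in atTop,
      (fun T => 2 * Real.pi * (aPoints a T₀ B T).ncard + criticalArg T) =O[atTop] Real.log := by
  filter_upwards [eventually_ncard_aPoints_le ha B, eventually_le_ncard_aPoints ha hB,
    eventually_ge_atTop 100]
    with T₀ hle hge hT₀
  have hO : (fun T => |criticalArg T₀| + |criticalArg (T₀ + 1)| + (1 + 2 * Real.pi) + Real.log T)
      =O[atTop] Real.log :=
    Real.isLittleO_const_log_atTop.isBigO.add (isBigO_refl _ _)
  refine IsBigO.trans (IsBigO.of_norm_eventuallyLE ?_) hO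
  filter_upwards [eventually_ge_atTop (T₀ + 2)] with T hT
  have hlog : 0 ≤ Real.log T := Real.log_nonneg (by linarith)
  have hlast := criticalArg_sub_one_le (T := T) (by linarith)
  rw [Real.norm_eq_abs, abs_le]
  constructor
  · linarith [hge T hT, neg_abs_le (criticalArg (T₀ + 1)), abs_nonneg (criticalArg T₀)]
  · linarith [hle T (by linarith), le_abs_self (criticalArg T₀),
      abs_nonneg (criticalArg (T₀ + 1))]

theorem eventually_ncard_aPoints_sub_mainTerm_isBigO_log {a : ℂ} (ha : a ≠ 0) {B : EReal}
    (hB : ((1 / 2 : ℝ) : EReal) < B) : ∀ᶠ T₀ : ℝ in atTop,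
      (fun T => (aPoints a T₀ B T).ncard - mainTerm T / (2 * Real.pi)) =O[atTop] Real.log := by
  filter_upwards [eventually_ncard_aPoints_add_criticalArg_isBigO_log ha hB] with T₀ hO
  refine ((hO.sub criticalArg_add_mainTerm_isBigO_log).const_mul_left
    (2 * Real.pi)⁻¹).congr_left fun T => ?_
  field_simp
  ring

end Counting

section Multiplicity

theorem analyticOrderNatAt_feDelta_sub {a s : ℂ} (hre : 0 < s.re) (him : 100 ≤ s.im)
    (hsa : feDelta s = a) : analyticOrderNatAt (fun z : ℂ => feDelta z - a) s = 1 := by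
  have hderiv : deriv feDelta s ≠ 0 := by
    intro hzero
    have hle := re_logDeriv_feDelta_le_one_sub hre him
    rw [logDeriv_apply, hzero, zero_div, zero_re] at hle
    linarith [two_le_log_div_two_pi him]
  have hanalytic : AnalyticAt ℂ feDelta s := by
    rw [analyticAt_iff_eventually_differentiableAt]
    filter_upwards [continuous_re.continuousAt.eventually_const_lt hre,
      continuous_im.continuousAt.eventually_const_lt (show 0 < s.im by linarith)] with z hzre hzim
    exact differentiableAt_feDelta hzre hzim
  rw [← hsa, analyticOrderNatAt, hanalytic.analyticOrderAt_sub_eq_one_of_deriv_ne_zero hderiv,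
    ENat.toNat_one]

theorem eventually_analyticOrderNatAt_feDelta_sub (a : ℂ) : ∀ᶠ T : ℝ in atTop, ∀ s : ℂ,
    T ≤ s.im → feDelta s = a → analyticOrderNatAt (fun z : ℂ => feDelta z - a) s = 1 := by
  filter_upwards [eventually_abs_re_sub_half_lt a one_half_pos, eventually_ge_atTop 100]
    with T hclose hT s him hsa
  have hre := (abs_lt.1 (hclose s him hsa)).1
  exact analyticOrderNatAt_feDelta_sub (by linarith) (hT.trans him) hsa

theorem aPoints_eq_union {a : ℂ} {t₀ T₀ T : ℝ} (B : EReal) (ht₀ : t₀ ≤ T₀) (hT : T₀ < T) :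
    aPoints a t₀ B T = (aPoints a t₀ B (T₀ + 1) ∩ {s | s.im ≤ T₀}) ∪ aPoints a T₀ B T := by
  ext s
  simp only [aPoints, Set.mem_union, Set.mem_inter_iff, Set.mem_ofPred_eq]
  grind

theorem finsum_aPoints_sub_mainTerm_isBigO_log {a : ℂ} (ha : a ≠ 0) {t₀ : ℝ} {B : EReal}
    (ht₀ : 0 ≤ t₀) (hB : ((1 / 2 : ℝ) : EReal) < B) (h : 0 < t₀ ∨ B < ⊤ ∨ a.im = 0) {w : ℂ → ℕ}
    (hw : ∀ᶠ T : ℝ in atTop, ∀ s : ℂ, T ≤ s.im → feDelta s = a → w s = 1) :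
    (fun T => ((∑ᶠ s ∈ aPoints a t₀ B T, w s : ℕ) : ℝ) - mainTerm T / (2 * Real.pi))
      =O[atTop] Real.log := by
  obtain ⟨T₀, hwT₀, hO, hT₀⟩ := (hw.and ((eventually_ncard_aPoints_sub_mainTerm_isBigO_log ha
    hB).and (eventually_ge_atTop t₀))).exists
  let low := aPoints a t₀ B (T₀ + 1) ∩ {s | s.im ≤ T₀}
  have hlow : low.Finite := (finite_aPoints ha ht₀ h _).inter_of_left _
  have hdisjoint (T : ℝ) : Disjoint low (aPoints a T₀ B T) :=
    Set.disjoint_left.2 fun s hs hs' => hs.2.not_gt hs'.2.2.2.1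
  have hconst : (fun _ : ℝ => ((∑ᶠ s ∈ low, w s : ℕ) : ℝ)) =O[atTop] Real.log :=
    Real.isLittleO_const_log_atTop.isBigO
  refine (hconst.add hO).congr' ?_ EventuallyEq.rfl
  filter_upwards [eventually_gt_atTop T₀] with T hT
  have hfin : (aPoints a T₀ B T).Finite := (finite_aPoints ha ht₀ h T).subset
    (aPoints_eq_union B hT₀ hT ▸ Set.subset_union_right)
  have hhigh : ∑ᶠ s ∈ aPoints a T₀ B T, w s = (aPoints a T₀ B T).ncard :=
    (finsum_mem_congr rfl fun s hs => hwT₀ s hs.2.2.2.1.le hs.1).trans finsum_one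
  rw [aPoints_eq_union B hT₀ hT, finsum_mem_union (hdisjoint T) hlow hfin, hhigh]
  push_cast
  ring

end Multiplicity

section JuliaLine

theorem exists_feDelta_eq_near_critical_line {a : ℂ} (ha : a ≠ 0) {ε : ℝ} (hε : 0 < ε) (T : ℝ) :
    ∃ s : ℂ, feDelta s = a ∧ |s.re - 1 / 2| < ε ∧ T < s.im := by
  obtain ⟨T₀, hcount, hclose, hT₀, hT⟩ := ((eventually_le_ncard_aPoints ha
    (EReal.coe_lt_top _)).and
    ((eventually_abs_re_sub_half_lt a hε).and
      ((eventually_ge_atTop 100).and (eventually_ge_atTop T)))).exists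
  have hpi := Real.two_pi_pos
  have hdrop := criticalArg_sub_le (t := T₀ + 1) (u := T₀ + 1 + 2 * Real.pi + 1)
    (by linarith) (by linarith)
  have hle := hcount (T₀ + 1 + 2 * Real.pi + 1 + 1) (by linarith)
  rw [add_sub_cancel_right] at hle
  have hcard : 0 < (aPoints a T₀ ⊤ (T₀ + 1 + 2 * Real.pi + 1 + 1)).ncard := by
    have hpos := pos_of_mul_pos_right (lt_of_lt_of_le (by linarith) hle) hpi.le
    exact_mod_cast hpos
  obtain ⟨s, hsa, -, -, him, -⟩ := Set.nonempty_of_ncard_ne_zero hcard.ne'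
  exact ⟨s, hsa, hclose s him.le hsa, hT.trans_lt him⟩

theorem eq_half_of_isVerticalJuliaLine_feDelta {σ : ℝ} (hσ : IsVerticalJuliaLine feDelta σ) :
    σ = 1 / 2 := by
  by_contra hne
  let ε := |σ - 1 / 2| / 2
  have hε : 0 < ε := half_pos (abs_pos.2 (sub_ne_zero.2 hne))
  obtain ⟨T, hone, hnegOne, hT⟩ := ((eventually_abs_re_sub_half_lt 1 hε).and
    ((eventually_abs_re_sub_half_lt (-1) hε).and (eventually_gt_atTop 0))).exists
  have hfar (z : ℂ) (hz : |z.re - σ| < ε) : ¬ |z.re - 1 / 2| < ε := by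
    intro hz'
    have htriangle := abs_sub_le σ z.re (1 / 2)
    rw [abs_sub_comm σ z.re] at htriangle
    linarith [show |σ - 1 / 2| = 2 * ε from (mul_div_cancel₀ _ two_ne_zero).symm]
  have heq : (1 : ℂ) = -1 := hσ ε hε T hT
    (fun ⟨z, hz, hre, him⟩ => hfar z hre (hone z him.le hz))
    (fun ⟨z, hz, hre, him⟩ => hfar z hre (hnegOne z him.le hz))
  norm_num at heq

theorem isVerticalJuliaLine_feDelta_half : IsVerticalJuliaLine feDelta (1 / 2) := by
  intro ε hε T _
  have homitted (a : ℂ) (h : ¬ ∃ z : ℂ, feDelta z = a ∧ |z.re - 1 / 2| < ε ∧ T < z.im) : a = 0 :=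
    by_contra fun ha => h (exists_feDelta_eq_near_critical_line ha hε T)
  exact fun a ha b hb => (homitted a ha).trans (homitted b hb).symm

end JuliaLine

theorem theorem1 (a : ℂ) (ha : a ≠ 0) :
    -- the counting formula, with and without multiplicity
    (∀ (t₀ : ℝ) (B : EReal), 0 ≤ t₀ → ((1 / 2 : ℝ) : EReal) < B →
      (0 < t₀ ∨ B < ⊤ ∨ a.im = 0) →
        (∀ T : ℝ, (aPoints a t₀ B T).Finite) ∧
        (fun T : ℝ => (aPointCount a t₀ B T : ℝ)
            - T / (2 * Real.pi) * Real.log (T / (2 * Real.pi * Real.exp 1)))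
          =O[atTop] (fun T : ℝ => Real.log T) ∧
        (fun T : ℝ => ((aPoints a t₀ B T).ncard : ℝ)
            - T / (2 * Real.pi) * Real.log (T / (2 * Real.pi * Real.exp 1)))
          =O[atTop] (fun T : ℝ => Real.log T)) ∧
    -- the real parts of the `a`-points tend to `1/2` as the imaginary parts tend to infinity
    Tendsto Complex.re (comap Complex.im atTop ⊓ 𝓟 {s : ℂ | feDelta s = a}) (𝓝 (1 / 2)) ∧
    -- the critical line is the only vertical Julia line
    (∀ σ : ℝ, IsVerticalJuliaLine feDelta σ ↔ σ = 1 / 2) := by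
  have hmain (T : ℝ) : mainTerm T / (2 * Real.pi) =
      T / (2 * Real.pi) * Real.log (T / (2 * Real.pi * Real.exp 1)) := mul_div_right_comm _ _ _
  simp only [← hmain]
  refine ⟨fun t₀ B ht₀ hB h => ⟨finite_aPoints ha ht₀ h, ?_, ?_⟩, tendsto_re_of_feDelta_eq a,
    fun σ => ⟨eq_half_of_isVerticalJuliaLine_feDelta, ?_⟩⟩
  · exact finsum_aPoints_sub_mainTerm_isBigO_log ha ht₀ hB h
      (eventually_analyticOrderNatAt_feDelta_sub a)
  · simpa only [Pi.one_apply, finsum_one] using finsum_aPoints_sub_mainTerm_isBigO_log ha ht₀ hB h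
      (w := 1) (Eventually.of_forall fun _ _ _ _ => rfl)
  · rintro rfl
    exact isVerticalJuliaLine_feDelta_half
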